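/- Let $\Omega\subset\mathbb{R}^n$, $n\ge 1$, be open and bounded, let $X=L^2(\Omega)$ be the real Hilbert space with its usual norm $\|\cdot\|$ and scalar product, and let $T>0$. Let $f\colon[0,+\infty)\times\Omega\times\mathbb{R}\to\mathbb{R}$ be continuous and such that (a) there is $m>0$ with $|f(t,x,y)|\le m$ for all $t\ge0$, $x\in\Omega$, $y\in\mathbb{R}$; (b) there is $L>0$ with $|f(t,x,y_1)-f(t,x,y_2)|\le L|y_1-y_2|$ for all $t\ge0$, $x\in\Omega$, $y_1,y_2\in\mathbb{R}$; (c) $f(t,x,y)=f(t+T,x,y)$ for all $t\ge0$, $x\in\Omega$, $y\in\mathbb{R}$; (d) there are continuous functions $f_+,f_-\colon[0,+\infty)\times\Omega\to\mathbb{R}$ with $f_\pm(t,x)=\lim_{y\to\pm\infty}f(t,x,y)$ for all $t\ge0$, $x\in\Omega$. Let $F(t,u)(x):=f(t,x,u(x))$ for $t\ge 0$, $u\in X$. Let $A\colon D(A)\to X$ be a linear operator on $X$ such that $-A$ generates a compact $C_0$ semigroup $\{S_A(t)\}_{t\ge0}$ of bounded linear operators on $X$, let $\lambda$ be a real eigenvalue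 of $A$, and suppose that $$N_\lambda:=\mathrm{Ker}\,(A-\lambda I)=\mathrm{Ker}\,(A^*-\lambda I)=\mathrm{Ker}\,(I-e^{\lambda T}S_A(T)).$$ The space $N_\lambda$ is finite-dimensional. Let $P\colon X\to X$ be the orthogonal projection onto $N_\lambda$ and define $g\colon N_\lambda\to N_\lambda$ by $g(u):=\int_0^T PF(t,u)\,dt$. For $u\in N_\lambda$ put $$\ell(u):=\int_0^T\!\!\int_{\{u>0\}}f_+(t,x)u(x)\,dx\,dt+\int_0^T\!\!\int_{\{u<0\}}f_-(t,x)u(x)\,dx\,dt .$$ Let $B(0,R)$ be the open ball of radius $R$ about $0$ in $N_\lambda$, and let $\mathrm{deg_B}(g,B(0,R))$ denote the Brouwer degree of $g$ on $B(0,R)$ with respect to $0$. (i) If $\ell(u)>0$ for every $u\in N_\lambda$ with $\|u\|=1$, then there is $R_0>0$ such that $g(u)\ne0$ for all $u\in N_\lambda$ with $\|u\|\ge R_0$, and $\mathrm{deg_B}(g,B(0,R))=1$ for all $R\ge R_0$. (ii) If $\ell(u)<0$ for every $u\in N_\lambda$ with $\|u\|=1$, then there is $R_0>0$ such that $g(u)\ne0$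 for all $u\in N_\lambda$ with $\|u\|\ge R_0$, and $\mathrm{deg_B}(g,B(0,R))=(-1)^{\dim N_\lambda}$ for all $R\ge R_0$. -/

import Mathlib

open MeasureTheory Filter Topology
open scoped ContDiff

noncomputable section

/-! ### The Brouwer degree -/

namespace BrouwerDegree

variable {E : Type*} [NormedAddCommGroup E] [NormedSpace ℝ E]

/-- `f` is a smooth map having `0` as a regular value on `U`, and its distance to `g` on the
closure of `U` is smaller than the distance from `0` to `g(∂U)`. (For `U` bounded, `dim E < ∞` and
`f`, `g` continuous on the compact set `closure U`, the pointwise inequalities below say exactly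
that `max_{closure U} ‖f - g‖ < min_{∂U} ‖g‖`, without a convention for empty sets.) -/
structure IsRegularApprox (g : E → E) (U : Set E) (f : E → E) : Prop where
  smooth : ContDiff ℝ ∞ f
  close : ∀ x ∈ closure U, ∀ y ∈ frontier U, ‖f x - g x‖ < ‖g y‖
  regular : ∀ x ∈ U, f x = 0 → (fderiv ℝ f x).det ≠ 0

/-- The sum of the signs of the Jacobian determinants of `f` at the zeros of `f` in `U`. -/
def signCount (f : E → E) (U : Set E) : ℤ :=
  ∑ᶠ x ∈ {x | x ∈ U ∧ f x = 0}, ((SignType.sign (fderiv ℝ f x).det : SignType) : ℤ)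

/-- `d` is the Brouwer degree of `g` on `U` with respect to `0`: the triple `(g, U, 0)` is
admissible, and `d` is the sum of the signs of the Jacobians over the zeros in `U` of any smooth
map that is sufficiently close to `g` and has `0` as a regular value. -/
structure HasDegree (g : E → E) (U : Set E) (d : ℤ) : Prop where
  finiteDimensional : FiniteDimensional ℝ E
  isOpen : IsOpen U
  isBounded : Bornology.IsBounded U
  continuousOn : ContinuousOn g (closure U)
  ne_zero : ∀ x ∈ frontier U, g x ≠ 0
  exists_approx : ∃ f, IsRegularApprox g U f
  signCount_eq : ∀ f, IsRegularApprox g U f → signCount f U = d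

theorem HasDegree.unique {g : E → E} {U : Set E} {d d' : ℤ}
    (h : HasDegree g U d) (h' : HasDegree g U d') : d = d' := by
  obtain ⟨f, hf⟩ := h.exists_approx
  exact (h.signCount_eq f hf).symm.trans (h'.signCount_eq f hf)

open Classical in
/-- The Brouwer degree `deg_B(g, U) = deg_B(g, U, 0)` (the value is `0` by convention if the
triple is not admissible). -/
def degree (g : E → E) (U : Set E) : ℤ :=
  if h : ∃ d, HasDegree g U d then h.choose else 0

theorem HasDegree.degree_eq {g : E → E} {U : Set E} {d : ℤ} (h : HasDegree g U d) :
    degree g U = d := by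
  have hex : ∃ d, HasDegree g U d := ⟨d, h⟩
  rw [degree, dif_pos hex]
  exact hex.choose_spec.unique h

theorem hasDegree_of_degree_ne_zero {g : E → E} {U : Set E} (h : degree g U ≠ 0) :
    HasDegree g U (degree g U) := by
  by_cases hex : ∃ d, HasDegree g U d
  · rw [degree, dif_pos hex]
    exact hex.choose_spec
  · exact absurd (by rw [degree, dif_neg hex]) h

end BrouwerDegree

/-! ### Semigroups, generators, kernels -/

namespace Resonance

section Semigroup

variable {X : Type*} [NormedAddCommGroup X] [NormedSpace ℝ X]

/-- `S` (restricted to `[0, ∞)`) is a compact `C₀` semigroup of bounded linear operators. -/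
structure IsCompactC0Semigroup (S : ℝ → X →L[ℝ] X) : Prop where
  zero : S 0 = ContinuousLinearMap.id ℝ X
  add : ∀ s t : ℝ, 0 ≤ s → 0 ≤ t → S (s + t) = (S s).comp (S t)
  continuous : ∀ x, Tendsto (fun h => S h x) (𝓝[>] (0 : ℝ)) (𝓝 x)
  compact : ∀ t : ℝ, 0 < t → IsCompactOperator (S t)

/-- `-A` is the infinitesimal generator of `S`: the domain of `A` consists of the `x` for which
`(S h x - x) / h` converges as `h → 0+`, and the limit is then `-A x`. -/
def IsNegGenerator (A : X →ₗ.[ℝ] X) (S : ℝ → X →L[ℝ] X) : Prop :=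
  ∀ x y : X, (∃ hx : x ∈ A.domain, A ⟨x, hx⟩ = y) ↔
    Tendsto (fun h : ℝ => h⁻¹ • (S h x - x)) (𝓝[>] (0 : ℝ)) (𝓝 (-y))

/-- `Ker (A - l I)` for an unbounded operator `A`, as a subspace of `X`. -/
def eigenKer (A : X →ₗ.[ℝ] X) (l : ℝ) : Submodule ℝ X :=
  (LinearMap.ker (A.toFun - l • A.domain.subtype)).map A.domain.subtype

theorem mem_eigenKer {A : X →ₗ.[ℝ] X} {l : ℝ} {x : X} :
    x ∈ eigenKer A l ↔ ∃ hx : x ∈ A.domain, A ⟨x, hx⟩ = l • x := by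
  constructor
  · rintro ⟨⟨y, hy⟩, hk, rfl⟩
    exact ⟨hy, sub_eq_zero.mp hk⟩
  · rintro ⟨hx, h⟩
    exact ⟨⟨x, hx⟩, sub_eq_zero.mpr h, rfl⟩

end Semigroup

/-! ### The averaged nonlinearity on the kernel -/

/-- The real Hilbert space `L²(Ω)` for `Ω ⊆ ℝⁿ`. -/
abbrev L2 {n : ℕ} (Ω : Set (EuclideanSpace ℝ (Fin n))) : Type :=
  Lp ℝ 2 (volume.restrict Ω)

section Nonlinearity

variable {n : ℕ} {Ω : Set (EuclideanSpace ℝ (Fin n))}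

open Classical in
/-- The superposition operator `F(t,u)(x) = f(t,x,u(x))` on `L²(Ω)`. Under the assumptions of the
theorem the function on the right is always in `L²(Ω)`. -/
def superposition (f : ℝ → EuclideanSpace ℝ (Fin n) → ℝ → ℝ) (t : ℝ) (u : L2 Ω) : L2 Ω :=
  if h : MemLp (fun x => f t x (u x)) 2 (volume.restrict Ω) then h.toLp else 0

open Classical in
/-- The orthogonal projection of `L²(Ω)` onto `N`, which exists if `N` is finite-dimensional (as
the kernel in the theorem is), or more generally closed. -/
def orthProj (N : Submodule ℝ (L2 Ω)) : L2 Ω →L[ℝ] N :=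
  if _h : N.HasOrthogonalProjection then N.orthogonalProjectionOnto else 0

/-- The mapping `g : N → N`, `g(u) = ∫₀ᵀ P F(t,u) dt`. -/
def averaged (f : ℝ → EuclideanSpace ℝ (Fin n) → ℝ → ℝ) (T : ℝ) (N : Submodule ℝ (L2 Ω))
    (u : N) : N :=
  ∫ t in (0 : ℝ)..T, orthProj N (superposition f t (u : L2 Ω))

/-- The Landesman-Lazer functional
`∫₀ᵀ ∫_{u>0} f₊(t,x) u(x) dx dt + ∫₀ᵀ ∫_{u<0} f₋(t,x) u(x) dx dt`. -/
def landesmanLazer (fp fm : ℝ → EuclideanSpace ℝ (Fin n) → ℝ) (T : ℝ) (u : L2 Ω) : ℝ :=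
  (∫ t in (0 : ℝ)..T, ∫ x in {x | x ∈ Ω ∧ 0 < u x}, fp t x * u x) +
    ∫ t in (0 : ℝ)..T, ∫ x in {x | x ∈ Ω ∧ u x < 0}, fm t x * u x

end Nonlinearity

end Resonance

end

/-! On a large sphere of `N` the field `g` points strictly outwards if `ℓ > 0` and strictly inwards
if `ℓ < 0`, so it is homotopic through nonvanishing fields to `c • id` with `c = 1` or `c = -1`,
whose degree is the sign of `c ^ dim N`.

The direction of `g` comes from compactness (`exists_forall_inner_averaged_pos`). If `c * ⟪g(u k), u
k⟫ ≤ 0` along `‖u k‖ → ∞`, the normalized `u k` have a limit `v` on the unit sphere of the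
finite-dimensional `N`, almost everywhere along a subsequence. Dominated convergence gives `⟪g(u k),
v⟫ → ℓ(v)`, and boundedness of `g` allows replacing `v` by the normalized `u k`; hence `c * ℓ(v) ≤
0`, a contradiction.

The degree is the sign count of regular approximations, so its homotopy invariance has to be proved
(`signCount_eq_of_homotopy`). The tool is that the integral of `det DF` over a bounded open `U`
depends only on `F` outside `U` (`integral_det_fderiv_eq`). For large `s` the map `s • id + F` is a
bijection with positive Jacobian, so the integral of its Jacobian is the volume of the image of `U`,
the complement of the image of `Uᶜ`; interpolation in `s` recovers `det DF`. Applied to `Φ ∘ f`,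
with `det DΦ` a bump near `0`, the integral is the sign count of `f` times a positive constant. -/

namespace BrouwerDegree

/-! ### The integral of a Jacobian determinant depends only on the values outside the set. -/

section Jacobian

theorem continuous_det_fderiv {E : Type*} [NormedAddCommGroup E]
    [NormedSpace ℝ E] {F : E → E} (hF : ContDiff ℝ 1 F) :
    Continuous fun x => (fderiv ℝ F x).det :=
  ContinuousLinearMap.continuous_det.comp (hF.continuous_fderiv one_ne_zero)

open Polynomial in
/-- The determinant of `M` is a combination of the determinants of `s • 1 + M`, for `s` in a set of
more than `dim E` nodes, with coefficients that depend only on the nodes. -/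
theorem exists_det_eq_sum_det_smul_add {E : Type*} [AddCommGroup E] [Module ℝ E]
    [FiniteDimensional ℝ E] (K : ℝ) :
    ∃ (t : Finset ℕ) (s c : ℕ → ℝ), (∀ i, K < s i) ∧ ∀ M : E →ₗ[ℝ] E,
      LinearMap.det M = ∑ i ∈ t, c i * LinearMap.det (s i • LinearMap.id + M) := by
  let t := Finset.range (Module.finrank ℝ E + 1)
  let s : ℕ → ℝ := fun i => K + 1 + i
  refine ⟨t, s, fun i => (Lagrange.basis t s i).eval 0,
    fun i => by simp only [s]; linarith [Nat.cast_nonneg (α := ℝ) i], fun M => ?_⟩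
  have hs : Set.InjOn s t := fun i _ j _ h => by simpa [s] using h
  -- `det (r • id + M)` is the characteristic polynomial of `-M` at `r`; its degree is `dim E`, so
  -- `dim E + 1` nodes determine its value at `0`.
  have hev : ∀ r : ℝ, ((-M).charpoly).eval r = LinearMap.det (r • LinearMap.id + M) := fun r => by
    rw [LinearMap.eval_charpoly, sub_neg_eq_add]
    rfl
  have hdeg : ((-M).charpoly).degree < t.card := by
    rw [Polynomial.degree_eq_natDegree (LinearMap.charpoly_monic _).ne_zero,
      LinearMap.charpoly_natDegree, Finset.card_range]
    exact_mod_cast Nat.lt_succ_self _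
  have h := congrArg (Polynomial.eval 0) (Lagrange.eq_interpolate hs hdeg)
  rw [hev, zero_smul, zero_add, Lagrange.interpolate_apply, Polynomial.eval_finsetSum] at h
  rw [h]
  refine Finset.sum_congr rfl fun i _ => ?_
  rw [Polynomial.eval_mul, Polynomial.eval_C, hev, mul_comm]

variable {E : Type*} [NormedAddCommGroup E] [NormedSpace ℝ E] [FiniteDimensional ℝ E]

/-- No `s • id + t • M` with `t ∈ [0, 1]` is singular, since a kernel vector would give `s * ‖v‖ ≤
‖M‖ * ‖v‖`; the determinant therefore keeps the sign it has at `t = 0`. -/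
theorem det_smul_id_add_pos (M : E →L[ℝ] E) {s : ℝ} (hs : ‖M‖ < s) :
    0 < (s • ContinuousLinearMap.id ℝ E + M).det := by
  have hs0 : 0 < s := (norm_nonneg M).trans_lt hs
  let p : ℝ → ℝ := fun t => (s • ContinuousLinearMap.id ℝ E + t • M).det
  have hp : Continuous p := ContinuousLinearMap.continuous_det.comp (by fun_prop)
  have hne : ∀ t ∈ Set.Icc (0 : ℝ) 1, p t ≠ 0 := by
    intro t ht h0
    have : ∃ v : E, v ≠ 0 ∧ (s • ContinuousLinearMap.id ℝ E + t • M) v = 0 := by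
      by_contra! hc
      have hinj : LinearMap.ker ((s • ContinuousLinearMap.id ℝ E + t • M : E →L[ℝ] E) :
          E →ₗ[ℝ] E) = ⊥ := by
        rw [LinearMap.ker_eq_bot']
        intro v hv
        by_contra hv0
        exact hc v hv0 hv
      exact (LinearMap.det_eq_zero_iff_ker_ne_bot.1 h0) hinj
    obtain ⟨v, hv0, hv⟩ := this
    have h1 : s • v = -(t • M v) := eq_neg_of_add_eq_zero_left (by simpa using hv)
    have h2 : s * ‖v‖ = t * ‖M v‖ := by
      have := congrArg norm h1
      rwa [norm_neg, norm_smul, norm_smul, Real.norm_of_nonneg hs0.le,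
        Real.norm_of_nonneg ht.1] at this
    have h3 := M.le_opNorm v
    have h4 : 0 < ‖v‖ := norm_pos_iff.2 hv0
    nlinarith [ht.1, ht.2, norm_nonneg (M v), norm_nonneg M, mul_pos (sub_pos.2 hs) h4,
      mul_nonneg (sub_nonneg.2 ht.2) (norm_nonneg (M v))]
  have h0 : 0 < p 0 := by
    simp only [p, zero_smul, add_zero]
    change 0 < LinearMap.det (s • LinearMap.id)
    rw [LinearMap.det_smul, LinearMap.det_id, mul_one]
    positivity
  have h1 : p 1 = (s • ContinuousLinearMap.id ℝ E + M).det := by simp [p]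
  rw [← h1]
  by_contra! hle
  obtain ⟨t, ht, ht0⟩ := intermediate_value_Icc' zero_le_one hp.continuousOn ⟨hle, h0.le⟩
  exact hne t ht ht0

/-- `s⁻¹ • F` is a contraction, so its sum with the identity is bijective. -/
theorem bijective_smul_add {F : E → E} {K : NNReal} (hF : LipschitzWith K F) {s : ℝ}
    (hs : (K : ℝ) < s) : Function.Bijective (fun x => s • x + F x) := by
  have hs0 : 0 < s := K.2.trans_lt hs
  have hF' : LipschitzWith (s.toNNReal⁻¹ * K) (fun x => s⁻¹ • F x) := by
    refine LipschitzWith.of_dist_le_mul fun x y => ?_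
    rw [dist_smul₀, NNReal.coe_mul, NNReal.coe_inv, Real.coe_toNNReal _ hs0.le, mul_assoc,
      Real.norm_of_nonneg (inv_nonneg.2 hs0.le)]
    exact mul_le_mul_of_nonneg_left (hF.dist_le_mul x y) (inv_nonneg.2 hs0.le)
  have hA : ApproximatesLinearOn (fun x => x + s⁻¹ • F x)
      ((ContinuousLinearEquiv.refl ℝ E : E ≃L[ℝ] E) : E →L[ℝ] E) Set.univ
      (s.toNNReal⁻¹ * K) := by
    intro x _ y _
    have := hF'.dist_le_mul x y
    rw [dist_eq_norm, dist_eq_norm] at this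
    refine (le_of_eq (congrArg norm ?_)).trans this
    simp only [ContinuousLinearEquiv.coe_coe, ContinuousLinearEquiv.refl_apply]
    abel
  have hc : Subsingleton E ∨ s.toNNReal⁻¹ * K <
      ‖((ContinuousLinearEquiv.refl ℝ E).symm : E →L[ℝ] E)‖₊⁻¹ := by
    rcases subsingleton_or_nontrivial E with h | h
    · exact Or.inl h
    · right
      have : ‖((ContinuousLinearEquiv.refl ℝ E).symm : E →L[ℝ] E)‖₊ = 1 := by
        change ‖ContinuousLinearMap.id ℝ E‖₊ = 1
        exact ContinuousLinearMap.nnnorm_id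
      rw [this, inv_one, ← NNReal.coe_lt_coe]
      push_cast
      rw [Real.coe_toNNReal _ hs0.le, inv_mul_lt_iff₀ hs0]
      linarith
  have hbij : Function.Bijective (fun x => x + s⁻¹ • F x) :=
    ⟨fun x y h => hA.injOn hc (Set.mem_univ x) (Set.mem_univ y) h, hA.surjective hc⟩
  have := (MulAction.bijective (Units.mk0 s hs0.ne')).comp hbij
  convert this using 1
  ext x
  simp [Function.comp, Units.smul_def, smul_smul, hs0.ne']

variable [MeasurableSpace E] [BorelSpace E] (μ : Measure E) [μ.IsAddHaarMeasure]

theorem integral_det_smul_add_eq {F : E → E} {K : NNReal} (hFc : ContDiff ℝ 1 F)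
    (hF : LipschitzWith K F) {U : Set E} (hU : MeasurableSet U) {s : ℝ} (hs : (K : ℝ) < s) :
    ∫ x in U, (s • ContinuousLinearMap.id ℝ E + fderiv ℝ F x).det ∂μ =
      μ.real ((fun x => s • x + F x) '' U) := by
  have hd : ∀ x ∈ U, HasFDerivWithinAt (fun x => s • x + F x)
      (s • ContinuousLinearMap.id ℝ E + fderiv ℝ F x) U x := fun x _ =>
    (((hasFDerivAt_id x).const_smul s).add
      (hFc.differentiable one_ne_zero x).hasFDerivAt).hasFDerivWithinAt
  have h := integral_image_eq_integral_abs_det_fderiv_smul μ hU hd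
    (bijective_smul_add hF hs).injective.injOn (fun _ => (1 : ℝ))
  rw [setIntegral_const, smul_eq_mul, mul_one] at h
  rw [h]
  refine setIntegral_congr_fun hU fun x _ => ?_
  have := det_smul_id_add_pos (fderiv ℝ F x) ((norm_fderiv_le_of_lipschitz ℝ hF).trans_lt hs)
  simp [abs_of_pos this]

theorem integrableOn_of_isBounded {f : E → ℝ} (hf : Continuous f) {U : Set E}
    (hb : Bornology.IsBounded U) : IntegrableOn f U μ :=
  (hf.continuousOn.integrableOn_compact hb.isCompact_closure).mono_set subset_closure

theorem integral_det_fderiv_eq_of_hasCompactSupport {F G : E → E} (hF : ContDiff ℝ 1 F)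
    (hG : ContDiff ℝ 1 G) (hFs : HasCompactSupport F) (hGs : HasCompactSupport G) {U : Set E}
    (hU : MeasurableSet U) (hb : Bornology.IsBounded U) (hFG : Set.EqOn F G Uᶜ) :
    ∫ x in U, (fderiv ℝ F x).det ∂μ = ∫ x in U, (fderiv ℝ G x).det ∂μ := by
  obtain ⟨K₁, hK₁⟩ := hF.lipschitzWith_of_hasCompactSupport hFs one_ne_zero
  obtain ⟨K₂, hK₂⟩ := hG.lipschitzWith_of_hasCompactSupport hGs one_ne_zero
  obtain ⟨t, s, c, hs, hdet⟩ :=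
    exists_det_eq_sum_det_smul_add (E := E) (max (K₁ : ℝ) (K₂ : ℝ))
  have key : ∀ H : E → E, ContDiff ℝ 1 H → ∫ x in U, (fderiv ℝ H x).det ∂μ =
      ∑ i ∈ t, c i * ∫ x in U, (s i • ContinuousLinearMap.id ℝ E + fderiv ℝ H x).det ∂μ := by
    intro H hH
    have h1 : ∀ x, (fderiv ℝ H x).det =
        ∑ i ∈ t, c i * (s i • ContinuousLinearMap.id ℝ E + fderiv ℝ H x).det :=
      fun x => hdet _
    simp_rw [h1]
    rw [integral_finsetSum]
    · simp_rw [integral_const_mul]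
    · intro i _
      refine Integrable.const_mul (integrableOn_of_isBounded μ ?_ hb) _
      exact ContinuousLinearMap.continuous_det.comp
        (continuous_const.add (hH.continuous_fderiv one_ne_zero))
  rw [key F hF, key G hG]
  refine Finset.sum_congr rfl fun i _ => ?_
  have h1 := (le_max_left _ _).trans_lt (hs i)
  have h2 := (le_max_right _ _).trans_lt (hs i)
  rw [integral_det_smul_add_eq μ hF hK₁ hU h1, integral_det_smul_add_eq μ hG hK₂ hU h2]
  -- By bijectivity the image of `U` is the complement of the image of `Uᶜ`, where the two maps
  -- agree.
  have him : (fun x => s i • x + F x) '' Uᶜ = (fun x => s i • x + G x) '' Uᶜ :=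
    Set.image_congr fun x hx => by rw [hFG hx]
  rw [Set.image_compl_eq (bijective_smul_add hK₁ h1),
    Set.image_compl_eq (bijective_smul_add hK₂ h2), compl_inj_iff] at him
  rw [him]

/-- The integral of the Jacobian determinant over a bounded open set depends only on the values
outside that set. -/
theorem integral_det_fderiv_eq {F G : E → E} (hF : ContDiff ℝ 1 F) (hG : ContDiff ℝ 1 G)
    {U : Set E} (hU : IsOpen U) (hb : Bornology.IsBounded U) (hFG : Set.EqOn F G Uᶜ) :
    ∫ x in U, (fderiv ℝ F x).det ∂μ = ∫ x in U, (fderiv ℝ G x).det ∂μ := by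
  obtain ⟨R, hR, hUR⟩ := hb.subset_closedBall_lt 0 0
  -- `η = 1` on a ball containing `U`: the factor leaves the derivatives on `U` and the agreement on
  -- `Uᶜ` intact.
  let η : ContDiffBump (0 : E) := ⟨R, R + 1, hR, by linarith⟩
  have hη : ContDiff ℝ 1 η := η.contDiff
  have key : ∀ H : E → E, ∫ x in U, (fderiv ℝ H x).det ∂μ =
      ∫ x in U, (fderiv ℝ (fun x => η x • H x) x).det ∂μ := by
    intro H
    refine setIntegral_congr_fun hU.measurableSet fun x hx => ?_
    have : (fun x => η x • H x) =ᶠ[𝓝 x] H := by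
      filter_upwards [hU.mem_nhds hx] with y hy
      rw [η.one_of_mem_closedBall (hUR hy), one_smul]
    simp only [this.fderiv_eq]
  rw [key F, key G]
  refine integral_det_fderiv_eq_of_hasCompactSupport μ (hη.smul hF) (hη.smul hG)
    η.hasCompactSupport.smul_right η.hasCompactSupport.smul_right hU.measurableSet hb ?_
  intro x hx
  change η x • F x = η x • G x
  rw [hFG hx]

end Jacobian

end BrouwerDegree

namespace BrouwerDegree

/-! ### Sign counts as integrals, and their homotopy invariance. -/

section Counting

variable {E : Type*} [NormedAddCommGroup E] [NormedSpace ℝ E]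

theorem det_fderiv_comp {Φ f : E → E} (hΦ : ContDiff ℝ 1 Φ) (hf : ContDiff ℝ 1 f) (x : E) :
    (fderiv ℝ (Φ ∘ f) x).det = (fderiv ℝ Φ (f x)).det * (fderiv ℝ f x).det := by
  rw [fderiv_comp x (hΦ.differentiable one_ne_zero _) (hf.differentiable one_ne_zero _)]
  exact LinearMap.det_comp _ _

variable [FiniteDimensional ℝ E]

/-- There is a map whose Jacobian determinant is a nonnegative bump concentrated near `0`. -/
theorem exists_jacobian_bump [Nontrivial E] [MeasurableSpace E] [BorelSpace E] (μ : Measure E)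
    [μ.IsAddHaarMeasure] {ε : ℝ} (hε : 0 < ε) :
    ∃ Φ : E → E, ContDiff ℝ 1 Φ ∧ (∀ y, ε ≤ ‖y‖ → (fderiv ℝ Φ y).det = 0) ∧
      0 < ∫ y, (fderiv ℝ Φ y).det ∂μ := by
  obtain ⟨e, he⟩ := exists_ne (0 : E)
  obtain ⟨lam, hlam⟩ := SeparatingDual.exists_eq_one (R := ℝ) he
  let δ : ℝ := ε / (1 + ‖e‖)
  have hden : 0 < 1 + ‖e‖ := by positivity
  have hδ : 0 < δ := div_pos hε hden
  let b : ContDiffBump (0 : E) := ⟨δ / 2, δ, half_pos hδ, half_lt_self hδ⟩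
  have hb : ContDiff ℝ 1 b := b.contDiff
  have hA : ContDiff ℝ 1 Real.smoothTransition := Real.smoothTransition.contDiff
  let q : E →L[ℝ] E := ContinuousLinearMap.id ℝ E - lam.smulRight e
  have hqe : q e = 0 := by simp [q, hlam]
  -- As `q e = 0`, only the transition factor varies along `e`, and the `e`-derivative of `ψ` is
  -- `φ`.
  let ψ : E → ℝ := fun y => δ * Real.smoothTransition (δ⁻¹ * lam y) * b (q y)
  have hψ : ContDiff ℝ 1 ψ := by
    refine (contDiff_const.mul (hA.comp (contDiff_const.mul lam.contDiff))).mul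
      (hb.comp q.contDiff)
  let φ : E → ℝ := fun y => deriv Real.smoothTransition (δ⁻¹ * lam y) * b (q y)
  have hψe : ∀ y, fderiv ℝ ψ y e = φ y := by
    intro y
    have h1 : HasFDerivAt (fun y => Real.smoothTransition (δ⁻¹ * lam y))
        (deriv Real.smoothTransition (δ⁻¹ * lam y) • (δ⁻¹ • lam)) y :=
      (hA.differentiable one_ne_zero _).hasDerivAt.comp_hasFDerivAt y
        (lam.hasFDerivAt.const_mul δ⁻¹)
    have h2 : HasFDerivAt (fun y => b (q y)) ((fderiv ℝ b (q y)).comp q) y :=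
      (hb.differentiable one_ne_zero _).hasFDerivAt.comp y q.hasFDerivAt
    have h3 := (h1.const_mul δ).mul h2
    have h4 : fderiv ℝ ψ y = _ := h3.fderiv
    rw [h4]
    simp only [φ, add_apply, smul_apply,
      ContinuousLinearMap.comp_apply, hqe, hlam, map_zero, smul_eq_mul]
    field_simp
    ring
  -- Only the coordinate `lam` along `e` is changed, into `ψ`; the derivative is a rank-one
  -- perturbation of the identity, with determinant `1 + (Dψ - lam) e = φ`.
  let Φ : E → E := fun y => y + (ψ y - lam y) • e
  have hΦ : ContDiff ℝ 1 Φ := contDiff_id.add ((hψ.sub lam.contDiff).smul contDiff_const)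
  have hdet : ∀ y, (fderiv ℝ Φ y).det = φ y := by
    intro y
    have h1 : HasFDerivAt Φ (ContinuousLinearMap.id ℝ E +
        (fderiv ℝ ψ y - lam).smulRight e) y :=
      (hasFDerivAt_id y).add
        (((hψ.differentiable one_ne_zero y).hasFDerivAt.sub lam.hasFDerivAt).smul_const e)
    rw [h1.fderiv]
    have h2 := LinearMap.transvection.det ((fderiv ℝ ψ y - lam : E →L[ℝ] ℝ) : E →ₗ[ℝ] ℝ) e
    have h3 : (ContinuousLinearMap.id ℝ E + (fderiv ℝ ψ y - lam).smulRight e).det =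
        1 + (fderiv ℝ ψ y - lam) e := h2
    rw [h3, sub_apply, hψe, hlam]
    ring
  have hzero : ∀ y, ε ≤ ‖y‖ → φ y = 0 := by
    intro y hy
    by_contra hne
    have hA0 := left_ne_zero_of_mul hne
    have hb0 := right_ne_zero_of_mul hne
    have hq : ‖q y‖ < δ := by
      have : q y ∈ Function.support b := hb0
      rw [b.support_eq, mem_ball_zero_iff] at this
      exact this
    have hl : |lam y| ≤ δ := by
      by_contra! hlt
      apply hA0
      have hev : Real.smoothTransition =ᶠ[𝓝 (δ⁻¹ * lam y)]
          fun _ => Real.smoothTransition (δ⁻¹ * lam y) := by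
        rcases lt_abs.1 hlt with h | h
        · have h1 : 1 < δ⁻¹ * lam y := by rwa [lt_inv_mul_iff₀ hδ, mul_one]
          filter_upwards [lt_mem_nhds h1] with z hz
          rw [Real.smoothTransition.one_of_one_le hz.le, Real.smoothTransition.one_of_one_le h1.le]
        · have h1 : δ⁻¹ * lam y < 0 := mul_neg_of_pos_of_neg (inv_pos.2 hδ) (by linarith)
          filter_upwards [gt_mem_nhds h1] with z hz
          rw [Real.smoothTransition.zero_of_nonpos hz.le,
            Real.smoothTransition.zero_of_nonpos h1.le]
      rw [hev.deriv_eq, deriv_const]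
    have hy' : y = q y + lam y • e := by simp [q]
    have : ‖y‖ < ε := calc
      ‖y‖ ≤ ‖q y‖ + ‖lam y • e‖ := by
        conv_lhs => rw [hy']
        exact norm_add_le _ _
      _ = ‖q y‖ + |lam y| * ‖e‖ := by rw [norm_smul, Real.norm_eq_abs]
      _ < δ + δ * ‖e‖ := add_lt_add_of_lt_of_le hq (by gcongr)
      _ = ε := by simp only [δ]; field_simp
    exact absurd hy this.not_ge
  have hφc : Continuous φ := by
    have : φ = fun y => (fderiv ℝ Φ y).det := funext fun y => (hdet y).symm
    rw [this]
    exact continuous_det_fderiv hΦ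
  refine ⟨Φ, hΦ, fun y hy => (hdet y).trans (hzero y hy), ?_⟩
  simp_rw [hdet]
  -- The mean value theorem yields a point where the transition function has slope `1`, hence a
  -- point where `φ` is nonzero.
  obtain ⟨c, -, hc⟩ := exists_deriv_eq_slope Real.smoothTransition zero_lt_one
    hA.continuous.continuousOn (hA.differentiable one_ne_zero).differentiableOn
  have hc1 : deriv Real.smoothTransition c = 1 := by rw [hc]; simp
  have hne : φ ((δ * c) • e) ≠ 0 := by
    have h1 : q ((δ * c) • e) = 0 := by rw [map_smul, hqe, smul_zero]
    have h2 : δ⁻¹ * lam ((δ * c) • e) = c := by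
      rw [map_smul, hlam, smul_eq_mul, mul_one, inv_mul_cancel_left₀ hδ.ne']
    simp only [φ]
    rw [h1, h2, hc1, b.one_of_mem_closedBall, mul_one]
    · exact one_ne_zero
    · exact Metric.mem_closedBall_self (half_pos hδ).le
  refine hφc.integral_pos_of_hasCompactSupport_nonneg_nonzero ?_ (fun y => ?_) hne
  · refine HasCompactSupport.of_support_subset_isCompact (isCompact_closedBall (0 : E) ε) ?_
    intro y hy
    rw [mem_closedBall_zero_iff]
    by_contra! h
    exact hy (hzero y h.le)
  · exact mul_nonneg Real.smoothTransition.monotone.deriv_nonneg b.nonneg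

open scoped Manifold in
theorem exists_contDiff_one_nhds_zero_off {Z U : Set E} (hZ : IsClosed Z) (hU : IsOpen U)
    (hZU : Z ⊆ U) : ∃ χ : E → ℝ, ContDiff ℝ 1 χ ∧ (∀ x ∈ Z, ∀ᶠ y in 𝓝 x, χ y = 1) ∧
      (∀ x ∉ U, χ x = 0) ∧ ∀ x, χ x ∈ Set.Icc (0 : ℝ) 1 := by
  obtain ⟨χ, h1, h2, h3⟩ := exists_contMDiffMap_one_nhds_of_subset_interior (n := 1) 𝓘(ℝ, E) hZ
    (hZU.trans hU.interior_eq.ge)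
  exact ⟨χ, χ.contMDiff.contDiff, fun x hx => h1.filter_mono (nhds_le_nhdsSet hx), h2, h3⟩

/-- Straight-line homotopy invariance of the degree integral. -/
theorem exists_integral_det_comp_eq_of_homotopy [MeasurableSpace E] [BorelSpace E] (μ : Measure E)
    [μ.IsAddHaarMeasure] {f₀ f₁ : E → E} (h₀ : ContDiff ℝ 1 f₀) (h₁ : ContDiff ℝ 1 f₁)
    {U : Set E} (hU : IsOpen U) (hb : Bornology.IsBounded U)
    (hne : ∀ t ∈ Set.Icc (0 : ℝ) 1, ∀ x ∈ frontier U, f₀ x + t • (f₁ x - f₀ x) ≠ 0) :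
    ∃ ε > 0, ∀ Φ : E → E, ContDiff ℝ 1 Φ → (∀ y, ε ≤ ‖y‖ → (fderiv ℝ Φ y).det = 0) →
      ∫ x in U, (fderiv ℝ (Φ ∘ f₀) x).det ∂μ = ∫ x in U, (fderiv ℝ (Φ ∘ f₁) x).det ∂μ := by
  let H : ℝ × E → E := fun p => f₀ p.2 + p.1 • (f₁ p.2 - f₀ p.2)
  have hH : Continuous H := by
    have := h₀.continuous
    have := h₁.continuous
    fun_prop
  have hcl : IsCompact (closure U) := hb.isCompact_closure
  have hfr : IsCompact (frontier U) := hcl.of_isClosed_subset isClosed_frontier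
    frontier_subset_closure
  obtain ⟨ε, hε, hεH⟩ := ((isCompact_Icc (a := (0 : ℝ)) (b := 1)).prod hfr).exists_forall_le'
    (f := fun p => ‖H p‖) hH.norm.continuousOn (a := 0)
    (fun p hp => norm_pos_iff.2 (hne p.1 hp.1 p.2 hp.2))
  -- The points at which the homotopy comes within `ε / 2` of zero at some time; they stay away from
  -- the frontier.
  let Z : Set E := Prod.snd '' ((Set.Icc (0 : ℝ) 1 ×ˢ closure U) ∩ {p | ‖H p‖ ≤ ε / 2})
  have hZc : IsCompact Z := by
    refine IsCompact.image ?_ continuous_snd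
    exact (isCompact_Icc.prod hcl).inter_right (isClosed_le hH.norm continuous_const)
  have hZU : Z ⊆ U := by
    rintro _ ⟨⟨t, x⟩, ⟨⟨ht, hx⟩, hp⟩, rfl⟩
    by_contra hxU
    have hxf : x ∈ frontier U := by
      rw [hU.frontier_eq]
      exact ⟨hx, hxU⟩
    have h1 := hεH (t, x) ⟨ht, hxf⟩
    have h2 : ‖H (t, x)‖ ≤ ε / 2 := hp
    linarith
  obtain ⟨χ, hχ, hχ1, hχ0, hχI⟩ := exists_contDiff_one_nhds_zero_off hZc.isClosed hU hZU
  refine ⟨ε / 2, half_pos hε, fun Φ hΦ hΦ0 => ?_⟩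
  -- The homotopy time is made a function of `x`: `F` is `f₀` outside `U` and `f₁` near `Z`.
  let F : E → E := fun x => f₀ x + χ x • (f₁ x - f₀ x)
  have hF : ContDiff ℝ 1 F := h₀.add (hχ.smul (h₁.sub h₀))
  have e1 : ∫ x in U, (fderiv ℝ (Φ ∘ F) x).det ∂μ = ∫ x in U, (fderiv ℝ (Φ ∘ f₀) x).det ∂μ := by
    refine integral_det_fderiv_eq μ (hΦ.comp hF) (hΦ.comp h₀) hU hb fun x hx => ?_
    simp [F, hχ0 x hx]
  rw [← e1]
  refine setIntegral_congr_fun hU.measurableSet fun x hx => ?_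
  by_cases hxZ : x ∈ Z
  · have : Φ ∘ F =ᶠ[𝓝 x] Φ ∘ f₁ := by
      filter_upwards [hχ1 x hxZ] with y hy
      simp [F, hy]
    rw [this.fderiv_eq]
  -- Off `Z` both `F x` (time `χ x`) and `f₁ x` (time `1`) lie where `det DΦ` vanishes.
  · have hbig : ∀ t ∈ Set.Icc (0 : ℝ) 1, ε / 2 ≤ ‖H (t, x)‖ := by
      intro t ht
      by_contra! hlt
      exact hxZ ⟨(t, x), ⟨⟨ht, subset_closure hx⟩, hlt.le⟩, rfl⟩
    rw [det_fderiv_comp hΦ hF, det_fderiv_comp hΦ h₁, hΦ0 (F x) (hbig _ (hχI x)), hΦ0 (f₁ x) ?_,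
      zero_mul, zero_mul]
    have := hbig 1 ⟨zero_le_one, le_rfl⟩
    simpa [H] using this

/-- Inverse function theorem. Injectivity isolates zeros and permits a change of variables; openness
at `z` makes the image cover a ball about `f z`. -/
theorem exists_nhds_injOn_sign_eq {f : E → E} (hf : ContDiff ℝ 1 f) {z : E}
    (hz : (fderiv ℝ f z).det ≠ 0) :
    (∃ W ∈ 𝓝 z, Set.InjOn f W ∧ ∀ x ∈ W,
      SignType.sign (fderiv ℝ f x).det = SignType.sign (fderiv ℝ f z).det) ∧
    ∀ V ∈ 𝓝 z, f '' V ∈ 𝓝 (f z) := by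
  have hs : HasStrictFDerivAt f
      (((fderiv ℝ f z).toContinuousLinearEquivOfDetNeZero hz : E ≃L[ℝ] E) : E →L[ℝ] E) z := by
    rw [ContinuousLinearMap.coe_toContinuousLinearEquivOfDetNeZero]
    exact hf.contDiffAt.hasStrictFDerivAt one_ne_zero
  refine ⟨?_, fun V hV => ?_⟩
  · let e := hs.toOpenPartialHomeomorph f
    have hsign : ∀ᶠ x in 𝓝 z,
        SignType.sign (fderiv ℝ f x).det = SignType.sign (fderiv ℝ f z).det := by
      have h1 : ContinuousAt (fun x => SignType.sign (fderiv ℝ f x).det) z :=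
        ContinuousAt.comp (f := fun x => (fderiv ℝ f x).det) (g := SignType.sign)
          (continuousAt_sign_of_ne_zero hz) (continuous_det_fderiv hf).continuousAt
      exact h1.eventually_mem
        ((isOpen_discrete {SignType.sign (fderiv ℝ f z).det}).mem_nhds rfl)
    refine ⟨e.source ∩ _, inter_mem (e.open_source.mem_nhds
      hs.mem_toOpenPartialHomeomorph_source) hsign, ?_, fun x hx => hx.2⟩
    exact e.injOn.mono Set.inter_subset_left
  · rw [← hs.map_nhds_eq_of_equiv]
    exact image_mem_map hV

/-- The sign count as an integral. -/
theorem exists_integral_comp_mul_det_eq_signCount_mul [MeasurableSpace E] [BorelSpace E]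
    (μ : Measure E) [μ.IsAddHaarMeasure] {f : E → E} (hf : ContDiff ℝ 1 f) {U : Set E}
    (hU : IsOpen U) (hb : Bornology.IsBounded U) (hne : ∀ x ∈ frontier U, f x ≠ 0)
    (hreg : ∀ x ∈ U, f x = 0 → (fderiv ℝ f x).det ≠ 0) :
    ∃ ε > 0, ∀ φ : E → ℝ, Continuous φ → (∀ y, ε ≤ ‖y‖ → φ y = 0) →
      ∫ x in U, φ (f x) * (fderiv ℝ f x).det ∂μ = signCount f U * ∫ y, φ y ∂μ := by
  let Z : Set E := {x | x ∈ U ∧ f x = 0}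
  have hcl : IsCompact (closure U) := hb.isCompact_closure
  have hZeq : Z = closure U ∩ f ⁻¹' {0} := by
    ext x
    refine ⟨fun h => ⟨subset_closure h.1, h.2⟩, fun h => ⟨?_, h.2⟩⟩
    by_contra hxU
    exact hne x (by rw [hU.frontier_eq]; exact ⟨h.1, hxU⟩) h.2
  have hZc : IsCompact Z := by
    rw [hZeq]
    exact hcl.inter_right (isClosed_singleton.preimage hf.continuous)
  have hloc := fun z (hz : z ∈ Z) => exists_nhds_injOn_sign_eq hf (hreg z hz.1 hz.2)
  choose! W hW hinj hsign using fun z (hz : z ∈ Z) => (hloc z hz).1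
  have hZfin : Z.Finite := by
    obtain ⟨t, htZ, ht⟩ := hZc.elim_nhds_subcover W hW
    refine t.finite_toSet.subset fun x hx => ?_
    obtain ⟨z, hzt, hxz⟩ := Set.mem_iUnion₂.1 (ht hx)
    have hz := htZ z hzt
    rwa [hinj z hz hxz (mem_of_mem_nhds (hW z hz)) (hx.2.trans hz.2.symm)]
  obtain ⟨O, hO, hOd⟩ := hZfin.t2_separation
  let V : E → Set E := fun z => interior (W z) ∩ O z ∩ U
  have hVo : ∀ z, IsOpen (V z) := fun z => (isOpen_interior.inter (hO z).2).inter hU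
  have hzV : ∀ z ∈ Z, z ∈ V z := fun z hz =>
    ⟨⟨mem_interior_iff_mem_nhds.2 (hW z hz), (hO z).1⟩, hz.1⟩
  have hVW : ∀ z, V z ⊆ W z := fun z x hx => interior_subset hx.1.1
  have hUn : IsOpen (⋃ z ∈ Z, V z) := isOpen_biUnion fun z _ => hVo z
  -- `ε₁` bounds `‖f‖` from below off the neighbourhoods of the zeros; `ε₂` below is the radius of a
  -- ball contained in the image of each of them.
  obtain ⟨ε₁, hε₁, hfar⟩ := (hcl.diff hUn).exists_forall_le' (f := fun x => ‖f x‖)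
    hf.continuous.norm.continuousOn (a := 0) (fun x hx => norm_pos_iff.2 fun h0 =>
      hx.2 (Set.mem_iUnion₂.2 ⟨x, by rw [hZeq]; exact ⟨hx.1, h0⟩,
        hzV x (by rw [hZeq]; exact ⟨hx.1, h0⟩)⟩))
  have himg : (⋂ z ∈ Z, f '' V z) ∈ 𝓝 (0 : E) := by
    refine (biInter_mem hZfin).2 fun z hz => ?_
    have := (hloc z hz).2 (V z) ((hVo z).mem_nhds (hzV z hz))
    rwa [hz.2] at this
  obtain ⟨ε₂, hε₂, hball⟩ := Metric.mem_nhds_iff.1 himg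
  refine ⟨min ε₁ ε₂, lt_min hε₁ hε₂, fun φ hφ hφ0 => ?_⟩
  have hcont : Continuous fun x => φ (f x) * (fderiv ℝ f x).det :=
    (hφ.comp hf.continuous).mul (continuous_det_fderiv hf)
  have hsub : (⋃ z ∈ hZfin.toFinset, V z) ⊆ U := Set.iUnion₂_subset fun z _ x hx => hx.2
  rw [setIntegral_eq_of_subset_of_forall_sdiff_eq_zero hU.measurableSet hsub ?_,
    integral_biUnion_finset, signCount, finsum_mem_eq_finite_toFinset_sum _ hZfin, Int.cast_sum,
    Finset.sum_mul]
  · refine Finset.sum_congr rfl fun z hz => ?_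
    rw [hZfin.mem_toFinset] at hz
    -- The sign is constant on `V z`, so each zero contributes its sign times the integral of `φ`
    -- over `f '' V z`, which contains the support of `φ`.
    have h1 : ∫ x in V z, φ (f x) * (fderiv ℝ f x).det ∂μ = ∫ x in V z,
        (((SignType.sign (fderiv ℝ f z).det : SignType) : ℤ) : ℝ) *
          (|(fderiv ℝ f x).det| • φ (f x)) ∂μ := by
      refine setIntegral_congr_fun (hVo z).measurableSet fun x hx => ?_
      rw [← hsign z hz x (hVW z hx), smul_eq_mul, ← mul_assoc]
      have : (((SignType.sign (fderiv ℝ f x).det : SignType) : ℤ) : ℝ) * |(fderiv ℝ f x).det| =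
          (fderiv ℝ f x).det := by
        rw [SignType.intCast_cast]
        exact sign_mul_abs _
      rw [this, mul_comm]
    rw [h1, integral_const_mul, ← integral_image_eq_integral_abs_det_fderiv_smul μ
      (hVo z).measurableSet (fun x _ =>
        (hf.differentiable one_ne_zero x).hasFDerivAt.hasFDerivWithinAt)
      ((hinj z hz).mono (hVW z)) φ, setIntegral_eq_integral_of_forall_compl_eq_zero]
    intro y hy
    refine hφ0 y ?_
    by_contra! hlt
    exact hy (Set.mem_iInter₂.1 (hball (mem_ball_zero_iff.2 (hlt.trans_le (min_le_right _ _)))) z hz)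
  · exact fun z _ => (hVo z).measurableSet
  · intro z hz z' hz' hzz
    rw [hZfin.coe_toFinset] at hz hz'
    exact (hOd hz hz' hzz).mono (fun x hx => hx.1.2) (fun x hx => hx.1.2)
  · exact fun z _ => (integrableOn_of_isBounded μ hcont hb).mono_set fun x hx => hx.2
  · rintro x ⟨hxU, hx⟩
    rw [hφ0 (f x) ?_, zero_mul]
    refine (min_le_left _ _).trans (hfar x ⟨subset_closure hxU, ?_⟩)
    simpa using hx

end Counting

end BrouwerDegree

namespace BrouwerDegree

/-! ### Regular approximations and invariance of the sign count. -/

section Approximation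

variable {E : Type*} [NormedAddCommGroup E] [NormedSpace ℝ E] [FiniteDimensional ℝ E]

/-- Smooth `g`, then subtract a small regular value, which exists because the critical values form a
null set (Sard). -/
theorem exists_contDiff_regular_approx {g : E → E} (hg : Continuous g) {δ : ℝ} (hδ : 0 < δ) :
    ∃ f : E → E, ContDiff ℝ ∞ f ∧ (∀ x, ‖f x - g x‖ < δ) ∧
      ∀ x, f x = 0 → (fderiv ℝ f x).det ≠ 0 := by
  borelize E
  let μ : Measure E := Measure.addHaar
  obtain ⟨h, hh, hhg, -⟩ := hg.exists_contDiff_approx (⊤ : ℕ∞) (ε := fun _ => δ / 2)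
    continuous_const (fun _ => half_pos hδ)
  have hd : Differentiable ℝ h := hh.differentiable (by simp)
  have hnull : μ (h '' {x | (fderiv ℝ h x).det = 0}) = 0 :=
    addHaar_image_eq_zero_of_det_fderivWithin_eq_zero μ
      (fun x _ => (hd x).hasFDerivAt.hasFDerivWithinAt) fun x hx => hx
  obtain ⟨v, hv, hvn⟩ : ∃ v ∈ Metric.ball (0 : E) (δ / 2),
      v ∉ h '' {x | (fderiv ℝ h x).det = 0} := by
    by_contra! hc
    have h1 := measure_mono_null (μ := μ) (show Metric.ball (0 : E) (δ / 2) ⊆ _ from hc) hnull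
    exact (Metric.measure_ball_pos μ (0 : E) (half_pos hδ)).ne' h1
  refine ⟨fun x => h x - v, hh.sub contDiff_const, fun x => ?_, fun x hx h0 => ?_⟩
  · have h1 := hhg x
    rw [dist_eq_norm] at h1
    rw [mem_ball_zero_iff] at hv
    calc ‖h x - v - g x‖ = ‖(h x - g x) - v‖ := by congr 1; abel
      _ ≤ ‖h x - g x‖ + ‖v‖ := norm_sub_le _ _
      _ < δ := by linarith
  · rw [fderiv_sub_const] at h0
    exact hvn ⟨x, h0, sub_eq_zero.1 hx⟩

theorem integral_det_comp_eq_signCount_mul [MeasurableSpace E] [BorelSpace E] (μ : Measure E)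
    [μ.IsAddHaarMeasure] {f : E → E} (hf : ContDiff ℝ 1 f) {U : Set E}
    (hU : IsOpen U) (hb : Bornology.IsBounded U) (hne : ∀ x ∈ frontier U, f x ≠ 0)
    (hreg : ∀ x ∈ U, f x = 0 → (fderiv ℝ f x).det ≠ 0) :
    ∃ ε > 0, ∀ Φ : E → E, ContDiff ℝ 1 Φ → (∀ y, ε ≤ ‖y‖ → (fderiv ℝ Φ y).det = 0) →
      ∫ x in U, (fderiv ℝ (Φ ∘ f) x).det ∂μ =
        signCount f U * ∫ y, (fderiv ℝ Φ y).det ∂μ := by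
  obtain ⟨ε, hε, h⟩ := exists_integral_comp_mul_det_eq_signCount_mul μ hf hU hb hne hreg
  refine ⟨ε, hε, fun Φ hΦ hΦ0 => ?_⟩
  rw [← h _ (continuous_det_fderiv hΦ) hΦ0]
  exact integral_congr_ae (Eventually.of_forall fun x => det_fderiv_comp hΦ hf x)

/-- Homotopy invariance of the sign count along a straight-line homotopy. -/
theorem signCount_eq_of_homotopy [Nontrivial E] {f₀ f₁ : E → E} (h₀ : ContDiff ℝ 1 f₀)
    (h₁ : ContDiff ℝ 1 f₁) {U : Set E} (hU : IsOpen U) (hb : Bornology.IsBounded U)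
    (hne : ∀ t ∈ Set.Icc (0 : ℝ) 1, ∀ x ∈ frontier U, f₀ x + t • (f₁ x - f₀ x) ≠ 0)
    (hr₀ : ∀ x ∈ U, f₀ x = 0 → (fderiv ℝ f₀ x).det ≠ 0)
    (hr₁ : ∀ x ∈ U, f₁ x = 0 → (fderiv ℝ f₁ x).det ≠ 0) :
    signCount f₀ U = signCount f₁ U := by
  borelize E
  let μ : Measure E := Measure.addHaar
  obtain ⟨ε, hε, h⟩ := exists_integral_det_comp_eq_of_homotopy μ h₀ h₁ hU hb hne
  obtain ⟨ε₀, hε₀, hc₀⟩ := integral_det_comp_eq_signCount_mul μ h₀ hU hb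
    (fun x hx => by simpa using hne 0 ⟨le_rfl, zero_le_one⟩ x hx) hr₀
  obtain ⟨ε₁, hε₁, hc₁⟩ := integral_det_comp_eq_signCount_mul μ h₁ hU hb
    (fun x hx => by simpa using hne 1 ⟨zero_le_one, le_rfl⟩ x hx) hr₁
  -- One bump serves the homotopy and both sign counts; its positive integral is cancelled at the
  -- end.
  obtain ⟨Φ, hΦ, hΦ0, hpos⟩ := exists_jacobian_bump μ (lt_min hε (lt_min hε₀ hε₁))
  have e := h Φ hΦ fun y hy => hΦ0 y ((min_le_left _ _).trans hy)
  rw [hc₀ Φ hΦ fun y hy => hΦ0 y ((min_le_right _ _).trans ((min_le_left _ _).trans hy)),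
    hc₁ Φ hΦ fun y hy => hΦ0 y ((min_le_right _ _).trans ((min_le_right _ _).trans hy))] at e
  exact_mod_cast mul_right_cancel₀ hpos.ne' e

theorem signCount_smul_id {c : ℝ} (hc : c ≠ 0) {U : Set E} (h0 : (0 : E) ∈ U) :
    signCount (fun x : E => c • x) U =
      ((SignType.sign (c ^ Module.finrank ℝ E) : SignType) : ℤ) := by
  have hset : {x : E | x ∈ U ∧ c • x = 0} = {0} := by
    ext x
    simp only [Set.mem_ofPred_eq, smul_eq_zero, hc, false_or, Set.mem_singleton_iff]
    exact ⟨fun h => h.2, fun h => ⟨h ▸ h0, h⟩⟩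
  have hdet : (fderiv ℝ (fun x : E => c • x) 0).det = c ^ Module.finrank ℝ E := by
    have h1 : HasFDerivAt (fun x : E => c • x) (c • ContinuousLinearMap.id ℝ E) 0 :=
      (hasFDerivAt_id (0 : E)).const_smul c
    rw [h1.fderiv]
    change LinearMap.det (c • LinearMap.id) = _
    rw [LinearMap.det_smul, LinearMap.det_id, mul_one]
  rw [signCount, hset, finsum_mem_singleton, hdet]

end Approximation

/-! ### The degree on a ball of a field pointing outwards or inwards. -/

section Ball

variable {E : Type*} [NormedAddCommGroup E] [InnerProductSpace ℝ E] [FiniteDimensional ℝ E]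
  [Nontrivial E]

/-- A continuous field that points outwards (`c > 0`) or inwards (`c < 0`) on a sphere has the
degree of `c • id` on the ball. -/
theorem hasDegree_ball_of_inner_pos {g : E → E} (hg : Continuous g) {c R : ℝ} (hc : c ≠ 0)
    (hR : 0 < R) (hpos : ∀ x : E, ‖x‖ = R → 0 < c * inner ℝ (g x) x) :
    HasDegree g (Metric.ball 0 R)
      ((SignType.sign (c ^ Module.finrank ℝ E) : SignType) : ℤ) := by
  have hfr : frontier (Metric.ball (0 : E) R) = Metric.sphere 0 R := frontier_ball 0 hR.ne'
  have hne : ∀ x ∈ frontier (Metric.ball (0 : E) R), g x ≠ 0 := by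
    intro x hx h0
    rw [hfr, mem_sphere_zero_iff_norm] at hx
    have := hpos x hx
    rw [h0, inner_zero_left, mul_zero] at this
    exact lt_irrefl _ this
  obtain ⟨m, hm, hgm⟩ := (isCompact_sphere (0 : E) R).exists_forall_le' (f := fun x => ‖g x‖)
    hg.norm.continuousOn (a := 0) (fun x hx => norm_pos_iff.2 (hne x (hfr ▸ hx)))
  obtain ⟨p, hp, hgp⟩ := (isCompact_sphere (0 : E) R).exists_forall_le'
    (f := fun x => c * inner ℝ (g x) x) (by fun_prop) (a := 0)
    (fun x hx => hpos x (mem_sphere_zero_iff_norm.1 hx))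
  have hcR : 0 < |c| * R := mul_pos (abs_pos.2 hc) hR
  -- Closeness `m` makes `q` a regular approximation of `g`; closeness `p / (|c| * R)` keeps `c * ⟪q
  -- x, x⟫` positive on the sphere.
  obtain ⟨q, hq, hqg, hqreg⟩ := exists_contDiff_regular_approx hg
    (lt_min hm (div_pos hp hcR))
  have hqpos : ∀ x : E, ‖x‖ = R → 0 < c * inner ℝ (q x) x := by
    intro x hx
    have h1 := hgp x (mem_sphere_zero_iff_norm.2 hx)
    have h2 : |c * inner ℝ (q x - g x) x| < p := calc
      |c * inner ℝ (q x - g x) x| ≤ |c| * (‖q x - g x‖ * ‖x‖) := by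
        rw [abs_mul]
        exact mul_le_mul_of_nonneg_left (abs_real_inner_le_norm _ _) (abs_nonneg c)
      _ = ‖q x - g x‖ * (|c| * R) := by rw [hx]; ring
      _ < p := by
        rw [← lt_div_iff₀ hcR]
        exact (hqg x).trans_le (min_le_right _ _)
    rw [inner_sub_left, mul_sub] at h2
    have := (abs_lt.1 h2).1
    linarith
  have hqcount : signCount q (Metric.ball 0 R) =
      ((SignType.sign (c ^ Module.finrank ℝ E) : SignType) : ℤ) := by
    rw [← signCount_smul_id (E := E) hc (Metric.mem_ball_self hR)]
    refine signCount_eq_of_homotopy (f₁ := fun x => c • x) (hq.of_le (by simp))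
      (contDiff_id.const_smul c)
      Metric.isOpen_ball Metric.isBounded_ball ?_ (fun x _ => hqreg x) ?_
    · intro t ht x hx h0
      rw [hfr, mem_sphere_zero_iff_norm] at hx
      have h1 := hqpos x hx
      have h2 : 0 < c * (c * inner ℝ x x) := by
        rw [real_inner_self_eq_norm_sq, hx, ← mul_assoc]
        exact mul_pos (mul_self_pos.2 hc) (pow_pos hR 2)
      have h3 : (1 - t) * (c * inner ℝ (q x) x) + t * (c * (c * inner ℝ x x)) = 0 := by
        have := congrArg (fun y => c * inner ℝ y x) h0
        simp only [inner_add_left, real_inner_smul_left, inner_sub_left, inner_zero_left] at this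
        linarith
      rcases ht.1.eq_or_lt with rfl | ht0
      · simp only [sub_zero, one_mul, zero_mul, add_zero] at h3
        exact h1.ne' h3
      · have h4 := mul_nonneg (sub_nonneg.2 ht.2) h1.le
        have h5 := mul_pos ht0 h2
        linarith
    · intro x _ _
      have h1 : HasFDerivAt (fun x : E => c • x) (c • ContinuousLinearMap.id ℝ E) x :=
        (hasFDerivAt_id x).const_smul c
      rw [h1.fderiv]
      change LinearMap.det (c • LinearMap.id) ≠ 0
      rw [LinearMap.det_smul, LinearMap.det_id, mul_one]
      exact pow_ne_zero _ hc
  refine ⟨inferInstance, Metric.isOpen_ball, Metric.isBounded_ball, hg.continuousOn, hne,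
    ⟨q, hq, fun x _ y hy => ?_, fun x _ => hqreg x⟩, fun f hf => ?_⟩
  · exact (hqg x).trans_le ((min_le_left _ _).trans (hgm y (hfr ▸ hy)))
  · rw [← hqcount]
    refine signCount_eq_of_homotopy (hf.smooth.of_le (by simp)) (hq.of_le (by simp))
      Metric.isOpen_ball Metric.isBounded_ball ?_ hf.regular (fun x _ => hqreg x)
    intro t ht x hx h0
    have h1 := hf.close x (frontier_subset_closure hx) x hx
    have h2 : ‖q x - g x‖ < ‖g x‖ :=
      (hqg x).trans_le ((min_le_left _ _).trans (hgm x (hfr ▸ hx)))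
    -- On the sphere `f x` and `q x` are both closer to `g x` than `0` is, so no convex combination
    -- of them vanishes.
    have h3 : g x = -((1 - t) • (f x - g x) + t • (q x - g x)) := by
      rw [← sub_eq_zero, ← h0]
      module
    have h4 : ‖g x‖ ≤ (1 - t) * ‖f x - g x‖ + t * ‖q x - g x‖ := by
      conv_lhs => rw [h3, norm_neg]
      refine (norm_add_le _ _).trans (le_of_eq ?_)
      rw [norm_smul, norm_smul, Real.norm_of_nonneg ht.1, Real.norm_of_nonneg (sub_nonneg.2 ht.2)]
    rcases ht.1.eq_or_lt with rfl | ht0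
    · simp only [sub_zero, one_mul, zero_mul, add_zero] at h4
      exact h4.not_gt h1
    · nlinarith [mul_nonneg (sub_nonneg.2 ht.2) (sub_pos.2 h1).le, mul_pos ht0 (sub_pos.2 h2)]

end Ball

end BrouwerDegree

namespace Resonance

/-! ### Finite dimension of the eigenspace. -/

section Kernel

variable {X : Type*} [NormedAddCommGroup X] [NormedSpace ℝ X]

/-- On the kernel `c • K` is the identity, so the identity is compact there, and Riesz's theorem
applies. -/
theorem finiteDimensional_ker_id_sub_smul {K : X →L[ℝ] X} (hK : IsCompactOperator K) (c : ℝ) :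
    FiniteDimensional ℝ (LinearMap.ker ((ContinuousLinearMap.id ℝ X - c • K : X →L[ℝ] X) :
      X →ₗ[ℝ] X)) := by
  set L : X →L[ℝ] X := ContinuousLinearMap.id ℝ X - c • K with hL
  let N := LinearMap.ker (L : X →ₗ[ℝ] X)
  have hN : ∀ x : N, c • K x = x := by
    intro x
    have h1 : L x = 0 := x.2
    rw [hL] at h1
    exact (sub_eq_zero.1 h1).symm
  have hclosed : IsClosed (N : Set X) := L.isClosed_ker
  have h1 : IsCompactOperator ((c • K) ∘ N.subtypeL) := by
    exact (hK.smul c).comp_clm N.subtypeL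
  have h2 : ∀ x : N, ((c • (K : X →ₗ[ℝ] X)) ∘ₗ N.subtype) x ∈ N := by
    intro x
    have : ((c • (K : X →ₗ[ℝ] X)) ∘ₗ N.subtype) x = x := hN x
    rw [this]
    exact x.2
  have h3 : IsCompactOperator (((c • (K : X →ₗ[ℝ] X)) ∘ₗ N.subtype).codRestrict N h2) :=
    IsCompactOperator.codRestrict h1 h2 hclosed
  have h4 : IsCompactOperator (id : N → N) := by
    convert h3 using 1
    ext x
    exact (hN x).symm
  exact FiniteDimensional.of_isCompactOperator_id (𝕜 := ℝ) h4

end Kernel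

/-! ### The superposition operator on `L²(Ω)`. -/

section Superposition

variable {n : ℕ} {Ω : Set (EuclideanSpace ℝ (Fin n))}

theorem aestronglyMeasurable_comp_of_continuousOn (hΩ : IsOpen Ω)
    {h : EuclideanSpace ℝ (Fin n) → ℝ → ℝ}
    (hh : ContinuousOn (fun p : EuclideanSpace ℝ (Fin n) × ℝ => h p.1 p.2) (Ω ×ˢ Set.univ))
    {v : EuclideanSpace ℝ (Fin n) → ℝ} (hv : Measurable v) :
    AEStronglyMeasurable (fun x => h x (v x)) (volume.restrict Ω) := by
  classical
  have hm : MeasurableSet (Ω ×ˢ (Set.univ : Set ℝ)) := hΩ.measurableSet.prod MeasurableSet.univ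
  have h1 : Measurable ((Ω ×ˢ (Set.univ : Set ℝ)).piecewise
      (fun p : EuclideanSpace ℝ (Fin n) × ℝ => h p.1 p.2) fun _ => 0) :=
    hh.measurable_piecewise continuousOn_const hm
  refine ⟨_, (h1.comp (measurable_id.prodMk hv)).stronglyMeasurable, ?_⟩
  filter_upwards [ae_restrict_mem hΩ.measurableSet] with x hx
  simp [Set.piecewise, hx]

/-- The standing assumptions on the domain and on the nonlinearity at nonnegative times. -/
structure IsAdmissibleNonlinearity (Ω : Set (EuclideanSpace ℝ (Fin n)))
    (f : ℝ → EuclideanSpace ℝ (Fin n) → ℝ → ℝ) (m L : ℝ) : Prop where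
  isOpen : IsOpen Ω
  isBounded : Bornology.IsBounded Ω
  continuousOn : ContinuousOn (fun p : ℝ × EuclideanSpace ℝ (Fin n) × ℝ => f p.1 p.2.1 p.2.2)
    (Set.Ici 0 ×ˢ Ω ×ˢ Set.univ)
  bound : ∀ t : ℝ, 0 ≤ t → ∀ x ∈ Ω, ∀ y : ℝ, |f t x y| ≤ m
  lipschitz_nonneg : 0 ≤ L
  lipschitz : ∀ t : ℝ, 0 ≤ t → ∀ x ∈ Ω, ∀ y₁ y₂ : ℝ, |f t x y₁ - f t x y₂| ≤ L * |y₁ - y₂|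

theorem isFiniteMeasure_restrict_of_isBounded (hb : Bornology.IsBounded Ω) :
    IsFiniteMeasure (volume.restrict Ω) :=
  isFiniteMeasure_restrict.2 hb.measure_lt_top.ne

theorem integrable_L2 (hb : Bornology.IsBounded Ω) (v : L2 Ω) :
    Integrable v (volume.restrict Ω) := by
  have := isFiniteMeasure_restrict_of_isBounded hb
  exact (Lp.memLp v).integrable one_le_two

/-- Continuity in time of `∫ h(t,x) v(x) dx` for bounded `h`, continuous in time. -/
theorem continuousOn_integral_mul (hΩ : IsOpen Ω) {h : ℝ → EuclideanSpace ℝ (Fin n) → ℝ} {m : ℝ}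
    (hmeas : ∀ t : ℝ, 0 ≤ t → AEStronglyMeasurable (h t) (volume.restrict Ω))
    (hcont : ∀ x ∈ Ω, ContinuousOn (fun t => h t x) (Set.Ici 0))
    (hbound : ∀ t : ℝ, 0 ≤ t → ∀ x ∈ Ω, |h t x| ≤ m)
    {v : EuclideanSpace ℝ (Fin n) → ℝ} (hv : Integrable v (volume.restrict Ω)) :
    ContinuousOn (fun t => ∫ x in Ω, h t x * v x) (Set.Ici 0) := by
  refine continuousOn_of_dominated (bound := fun x => m * |v x|)
    (fun t ht => (hmeas t ht).mul hv.aestronglyMeasurable) (fun t ht => ?_) (hv.abs.const_mul m) ?_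
  · filter_upwards [ae_restrict_mem hΩ.measurableSet] with x hx
    rw [Real.norm_eq_abs, abs_mul]
    exact mul_le_mul_of_nonneg_right (hbound t ht x hx) (abs_nonneg _)
  · filter_upwards [ae_restrict_mem hΩ.measurableSet] with x hx
    exact (hcont x hx).mul continuousOn_const

namespace IsAdmissibleNonlinearity

variable {f : ℝ → EuclideanSpace ℝ (Fin n) → ℝ → ℝ} {m L : ℝ}

theorem aestronglyMeasurable (hf : IsAdmissibleNonlinearity Ω f m L) {t : ℝ} (ht : 0 ≤ t)
    (u : L2 Ω) : AEStronglyMeasurable (fun x => f t x (u x)) (volume.restrict Ω) := by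
  refine aestronglyMeasurable_comp_of_continuousOn hf.isOpen ?_ (Lp.stronglyMeasurable u).measurable
  exact hf.continuousOn.comp (f := fun p : EuclideanSpace ℝ (Fin n) × ℝ => (t, p.1, p.2))
    (by fun_prop) fun p hp => ⟨ht, hp.1, hp.2⟩

theorem memLp (hf : IsAdmissibleNonlinearity Ω f m L) {t : ℝ} (ht : 0 ≤ t) (u : L2 Ω) :
    MemLp (fun x => f t x (u x)) 2 (volume.restrict Ω) := by
  have := isFiniteMeasure_restrict_of_isBounded hf.isBounded
  refine MemLp.of_bound (hf.aestronglyMeasurable ht u) m ?_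
  filter_upwards [ae_restrict_mem hf.isOpen.measurableSet] with x hx
  exact hf.bound t ht x hx _

theorem coeFn_superposition (hf : IsAdmissibleNonlinearity Ω f m L) {t : ℝ} (ht : 0 ≤ t)
    (u : L2 Ω) : superposition f t u =ᵐ[volume.restrict Ω] fun x => f t x (u x) := by
  rw [superposition, dif_pos (hf.memLp ht u)]
  exact MemLp.coeFn_toLp _

theorem inner_superposition (hf : IsAdmissibleNonlinearity Ω f m L) {t : ℝ} (ht : 0 ≤ t)
    (u w : L2 Ω) : inner ℝ w (superposition f t u) = ∫ x in Ω, f t x (u x) * w x := by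
  rw [L2.inner_def]
  refine integral_congr_ae ?_
  filter_upwards [hf.coeFn_superposition ht u] with x hx
  rw [hx]
  rfl

theorem norm_superposition_sub_le (hf : IsAdmissibleNonlinearity Ω f m L) {t : ℝ} (ht : 0 ≤ t)
    (u v : L2 Ω) : ‖superposition f t u - superposition f t v‖ ≤ L * ‖u - v‖ := by
  refine Lp.norm_le_mul_norm_of_ae_le_mul ?_
  filter_upwards [hf.coeFn_superposition ht u, hf.coeFn_superposition ht v,
    Lp.coeFn_sub (superposition f t u) (superposition f t v), Lp.coeFn_sub u v,
    ae_restrict_mem hf.isOpen.measurableSet] with x h1 h2 h3 h4 hx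
  rw [h3, h4, Pi.sub_apply, Pi.sub_apply, h1, h2]
  exact hf.lipschitz t ht x hx _ _

theorem exists_norm_superposition_le (hf : IsAdmissibleNonlinearity Ω f m L) :
    ∃ M : ℝ, ∀ t : ℝ, 0 ≤ t → ∀ u : L2 Ω, ‖superposition f t u‖ ≤ M := by
  have := isFiniteMeasure_restrict_of_isBounded hf.isBounded
  refine ⟨measureUnivNNReal (volume.restrict Ω) ^ (2 : ENNReal).toReal⁻¹ * |m|,
    fun t ht u => Lp.norm_le_of_ae_bound (abs_nonneg m) ?_⟩
  filter_upwards [hf.coeFn_superposition ht u, ae_restrict_mem hf.isOpen.measurableSet]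
    with x h1 hx
  rw [h1]
  exact (hf.bound t ht x hx _).trans (le_abs_self m)

theorem continuousOn_time (hf : IsAdmissibleNonlinearity Ω f m L) {x : EuclideanSpace ℝ (Fin n)}
    (hx : x ∈ Ω) (y : ℝ) : ContinuousOn (fun t => f t x y) (Set.Ici 0) :=
  hf.continuousOn.comp (f := fun t : ℝ => (t, x, y)) (by fun_prop) fun _ ht => ⟨ht, hx, trivial⟩

theorem continuousOn_inner_superposition (hf : IsAdmissibleNonlinearity Ω f m L) (u w : L2 Ω) :
    ContinuousOn (fun t => inner ℝ w (superposition f t u)) (Set.Ici 0) := by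
  refine (continuousOn_integral_mul hf.isOpen (h := fun t x => f t x (u x))
    (fun t ht => hf.aestronglyMeasurable ht u) (fun x hx => hf.continuousOn_time hx _)
    (fun t ht x hx => hf.bound t ht x hx _) (integrable_L2 hf.isBounded w)).congr ?_
  exact fun t ht => hf.inner_superposition ht u w

end IsAdmissibleNonlinearity

end Superposition

end Resonance

namespace Resonance

/-! ### The averaged map: weak formula, continuity, boundedness. -/

section Averaged

variable {n : ℕ} {Ω : Set (EuclideanSpace ℝ (Fin n))}

theorem inner_orthProj (N : Submodule ℝ (L2 Ω)) [FiniteDimensional ℝ N] (w : N) (u : L2 Ω) :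
    inner ℝ w (orthProj N u) = inner ℝ (w : L2 Ω) u := by
  rw [orthProj, dif_pos (inferInstance : N.HasOrthogonalProjection)]
  exact Submodule.inner_orthogonalProjectionOnto_eq_of_mem_left w u

theorem norm_orthProj_le (N : Submodule ℝ (L2 Ω)) [FiniteDimensional ℝ N] (u : L2 Ω) :
    ‖orthProj N u‖ ≤ ‖u‖ := by
  rw [orthProj, dif_pos (inferInstance : N.HasOrthogonalProjection)]
  exact Submodule.norm_orthogonalProjectionOnto_apply_le N u

namespace IsAdmissibleNonlinearity

variable {f : ℝ → EuclideanSpace ℝ (Fin n) → ℝ → ℝ} {m L T : ℝ}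

theorem intervalIntegrable_orthProj (hf : IsAdmissibleNonlinearity Ω f m L) (hT : 0 ≤ T)
    (N : Submodule ℝ (L2 Ω)) [FiniteDimensional ℝ N] (u : L2 Ω) :
    IntervalIntegrable (fun t => orthProj N (superposition f t u)) volume 0 T := by
  let b := stdOrthonormalBasis ℝ N
  have h1 : ContinuousOn (fun t => orthProj N (superposition f t u)) (Set.Ici 0) := by
    -- In an orthonormal basis of `N` the coordinates are scalar products with `F(t,u)`, so
    -- continuity in time is needed only for these.
    have h2 : (fun t => orthProj N (superposition f t u)) =
        fun t => ∑ i, inner ℝ (b i : L2 Ω) (superposition f t u) • b i := by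
      ext1 t
      rw [← b.sum_repr' (orthProj N (superposition f t u))]
      simp_rw [inner_orthProj]
    rw [h2]
    exact continuousOn_finsetSum _ fun i _ =>
      (hf.continuousOn_inner_superposition u (b i)).smul continuousOn_const
  refine (h1.mono ?_).intervalIntegrable
  rw [Set.uIcc_of_le hT]
  exact Set.Icc_subset_Ici_self

theorem inner_averaged (hf : IsAdmissibleNonlinearity Ω f m L) (hT : 0 ≤ T)
    (N : Submodule ℝ (L2 Ω)) [FiniteDimensional ℝ N] (u w : N) :
    inner ℝ w (averaged f T N u) = ∫ t in (0 : ℝ)..T, ∫ x in Ω, f t x ((u : L2 Ω) x) *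
      (w : L2 Ω) x := by
  have h1 := (innerSL ℝ w).intervalIntegral_comp_comm (hf.intervalIntegrable_orthProj hT N u)
  rw [averaged]
  refine h1.symm.trans (intervalIntegral.integral_congr fun t ht => ?_)
  rw [Set.uIcc_of_le hT] at ht
  change inner ℝ w (orthProj N (superposition f t u)) = _
  rw [inner_orthProj, hf.inner_superposition ht.1]

theorem continuous_averaged (hf : IsAdmissibleNonlinearity Ω f m L) (hT : 0 ≤ T)
    (N : Submodule ℝ (L2 Ω)) [FiniteDimensional ℝ N] : Continuous (averaged f T N) := by
  refine (LipschitzWith.of_dist_le_mul (K := .mk (L * T) (mul_nonneg hf.lipschitz_nonneg hT))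
    fun u v => ?_).continuous
  rw [dist_eq_norm, dist_eq_norm, averaged, averaged, ← intervalIntegral.integral_sub
    (hf.intervalIntegrable_orthProj hT N u) (hf.intervalIntegrable_orthProj hT N v)]
  refine (intervalIntegral.norm_integral_le_of_norm_le_const (C := L * ‖u - v‖)
    fun t ht => ?_).trans (le_of_eq ?_)
  · rw [Set.uIoc_of_le hT] at ht
    rw [← map_sub]
    exact (norm_orthProj_le N _).trans (hf.norm_superposition_sub_le ht.1.le u v)
  · rw [sub_zero, abs_of_nonneg hT, NNReal.coe_mk]
    ring

theorem exists_norm_averaged_le (hf : IsAdmissibleNonlinearity Ω f m L) (hT : 0 ≤ T)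
    (N : Submodule ℝ (L2 Ω)) [FiniteDimensional ℝ N] :
    ∃ M : ℝ, ∀ u : N, ‖averaged f T N u‖ ≤ M := by
  obtain ⟨M, hM⟩ := hf.exists_norm_superposition_le
  refine ⟨M * |T - 0|, fun u => intervalIntegral.norm_integral_le_of_norm_le_const fun t ht => ?_⟩
  rw [Set.uIoc_of_le hT] at ht
  exact (norm_orthProj_le N _).trans (hM t ht.1.le u)

end IsAdmissibleNonlinearity

end Averaged

/-! ### The Landesman-Lazer condition and the degree of the averaged map. -/

section LandesmanLazer

variable {n : ℕ} {Ω : Set (EuclideanSpace ℝ (Fin n))}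

theorem setIntegral_pos_eq (h : EuclideanSpace ℝ (Fin n) → ℝ) (v : L2 Ω) :
    ∫ x in {x | x ∈ Ω ∧ 0 < v x}, h x * v x = ∫ x in Ω, h x * max (v x) 0 := by
  have hm : MeasurableSet {x | 0 < v x} :=
    measurableSet_lt measurable_const (Lp.stronglyMeasurable v).measurable
  have hs : {x | x ∈ Ω ∧ 0 < v x} = Ω ∩ {x | 0 < v x} := rfl
  rw [hs, ← setIntegral_indicator hm]
  refine integral_congr_ae (Eventually.of_forall fun x => ?_)
  beta_reduce
  by_cases hx : 0 < v x
  · rw [Set.indicator_of_mem (by exact hx), max_eq_left hx.le]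
  · rw [Set.indicator_of_notMem (by exact hx), max_eq_right (not_lt.1 hx), mul_zero]

theorem setIntegral_neg_eq (h : EuclideanSpace ℝ (Fin n) → ℝ) (v : L2 Ω) :
    ∫ x in {x | x ∈ Ω ∧ v x < 0}, h x * v x = ∫ x in Ω, h x * min (v x) 0 := by
  have hm : MeasurableSet {x | v x < 0} :=
    measurableSet_lt (Lp.stronglyMeasurable v).measurable measurable_const
  have hs : {x | x ∈ Ω ∧ v x < 0} = Ω ∩ {x | v x < 0} := rfl
  rw [hs, ← setIntegral_indicator hm]
  refine integral_congr_ae (Eventually.of_forall fun x => ?_)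
  beta_reduce
  by_cases hx : v x < 0
  · rw [Set.indicator_of_mem (by exact hx), min_eq_left hx.le]
  · rw [Set.indicator_of_notMem (by exact hx), min_eq_right (not_lt.1 hx), mul_zero]

/-- `p` is the pointwise limit of `f` along the filter `F` in the state variable, and is
continuous. -/
structure IsLimitAt (Ω : Set (EuclideanSpace ℝ (Fin n)))
    (f : ℝ → EuclideanSpace ℝ (Fin n) → ℝ → ℝ) (F : Filter ℝ)
    (p : ℝ → EuclideanSpace ℝ (Fin n) → ℝ) : Prop where
  continuousOn : ContinuousOn (fun q : ℝ × EuclideanSpace ℝ (Fin n) => p q.1 q.2) (Set.Ici 0 ×ˢ Ω)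
  tendsto : ∀ t : ℝ, 0 ≤ t → ∀ x ∈ Ω, Tendsto (fun y => f t x y) F (𝓝 (p t x))

namespace IsAdmissibleNonlinearity

variable {f : ℝ → EuclideanSpace ℝ (Fin n) → ℝ → ℝ} {m L T : ℝ}
  {fp fm : ℝ → EuclideanSpace ℝ (Fin n) → ℝ}

theorem aestronglyMeasurable_limit (hf : IsAdmissibleNonlinearity Ω f m L) {F : Filter ℝ}
    {p : ℝ → EuclideanSpace ℝ (Fin n) → ℝ} (hp : IsLimitAt Ω f F p) {t : ℝ} (ht : 0 ≤ t) :
    AEStronglyMeasurable (p t) (volume.restrict Ω) := by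
  have h1 : ContinuousOn (p t) Ω := hp.continuousOn.comp
    (f := fun x : EuclideanSpace ℝ (Fin n) => (t, x)) (by fun_prop) fun x hx => ⟨ht, hx⟩
  exact h1.aestronglyMeasurable hf.isOpen.measurableSet

theorem abs_limit_le (hf : IsAdmissibleNonlinearity Ω f m L) {F : Filter ℝ} [F.NeBot]
    {p : ℝ → EuclideanSpace ℝ (Fin n) → ℝ} (hp : IsLimitAt Ω f F p) {t : ℝ} (ht : 0 ≤ t)
    {x : EuclideanSpace ℝ (Fin n)} (hx : x ∈ Ω) : |p t x| ≤ m :=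
  le_of_tendsto (hp.tendsto t ht x hx).abs (Eventually.of_forall fun y => hf.bound t ht x hx y)

theorem continuousOn_integral_limit_mul (hf : IsAdmissibleNonlinearity Ω f m L) {F : Filter ℝ}
    [F.NeBot] {p : ℝ → EuclideanSpace ℝ (Fin n) → ℝ} (hp : IsLimitAt Ω f F p)
    {v : EuclideanSpace ℝ (Fin n) → ℝ} (hv : Integrable v (volume.restrict Ω)) :
    ContinuousOn (fun t => ∫ x in Ω, p t x * v x) (Set.Ici 0) :=
  continuousOn_integral_mul hf.isOpen (fun _ ht => hf.aestronglyMeasurable_limit hp ht)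
    (fun x hx => hp.continuousOn.comp (f := fun t : ℝ => (t, x)) (by fun_prop)
      fun _ ht => ⟨ht, hx⟩)
    (fun _ ht _ hx => hf.abs_limit_le hp ht hx) hv

/-- With positive and negative parts the two set integrals become one over `Ω`, whose integrand is
the pointwise limit in `tendsto_mul`. -/
theorem landesmanLazer_eq (hf : IsAdmissibleNonlinearity Ω f m L) (hT : 0 ≤ T)
    (hp : IsLimitAt Ω f atTop fp) (hm : IsLimitAt Ω f atBot fm) (v : L2 Ω) :
    landesmanLazer fp fm T v = ∫ t in (0 : ℝ)..T, ∫ x in Ω,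
      (fp t x * max (v x) 0 + fm t x * min (v x) 0) := by
  have hv := integrable_L2 hf.isBounded v
  have hvp : Integrable (fun x => max (v x) 0) (volume.restrict Ω) := hv.pos_part
  have hvm : Integrable (fun x => min (v x) 0) (volume.restrict Ω) := hv.inf (integrable_zero _ _ _)
  have hsub : Set.uIcc 0 T ⊆ Set.Ici 0 := by
    rw [Set.uIcc_of_le hT]
    exact Set.Icc_subset_Ici_self
  rw [landesmanLazer]
  simp_rw [setIntegral_pos_eq, setIntegral_neg_eq]
  rw [← intervalIntegral.integral_add
    ((hf.continuousOn_integral_limit_mul hp hvp).mono hsub).intervalIntegrable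
    ((hf.continuousOn_integral_limit_mul hm hvm).mono hsub).intervalIntegrable]
  refine intervalIntegral.integral_congr fun t ht => ?_
  have ht0 := hsub ht
  have hint : ∀ {F : Filter ℝ} [F.NeBot] {p : ℝ → EuclideanSpace ℝ (Fin n) → ℝ}
      {w : EuclideanSpace ℝ (Fin n) → ℝ}, IsLimitAt Ω f F p → Integrable w (volume.restrict Ω) →
      Integrable (fun x => p t x * w x) (volume.restrict Ω) := by
    intro F _ p w hp hw
    refine hw.bdd_mul (c := m) (hf.aestronglyMeasurable_limit hp ht0) ?_
    filter_upwards [ae_restrict_mem hf.isOpen.measurableSet] with x hx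
    exact hf.abs_limit_le hp ht0 hx
  exact (integral_add (hint hp hvp) (hint hm hvm)).symm

/-- For `y ≠ 0` the argument `r k * z k` diverges with the sign of `y`; for `y = 0` the factor `y`
removes the term, whatever the argument does. -/
theorem tendsto_mul (hp : IsLimitAt Ω f atTop fp) (hm : IsLimitAt Ω f atBot fm) {t : ℝ}
    (ht : 0 ≤ t) {x : EuclideanSpace ℝ (Fin n)} (hx : x ∈ Ω)
    {y : ℝ} {z r : ℕ → ℝ} (hz : Tendsto z atTop (𝓝 y)) (hr : Tendsto r atTop atTop) :
    Tendsto (fun k => f t x (r k * z k) * y) atTop (𝓝 (fp t x * max y 0 + fm t x * min y 0)) := by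
  rcases lt_trichotomy y 0 with hy | rfl | hy
  · rw [max_eq_right hy.le, min_eq_left hy.le, mul_zero, zero_add]
    exact ((hm.tendsto t ht x hx).comp (hr.atTop_mul_neg hy hz)).mul_const y
  · simp
  · rw [max_eq_left hy.le, min_eq_right hy.le, mul_zero, add_zero]
    exact ((hp.tendsto t ht x hx).comp (hr.atTop_mul_pos hy hz)).mul_const y

/-- Along directions converging almost everywhere, the averaged nonlinearity tested against the
limit direction tends to the Landesman-Lazer functional. -/
theorem tendsto_integral_landesmanLazer (hf : IsAdmissibleNonlinearity Ω f m L) (hT : 0 ≤ T)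
    (hp : IsLimitAt Ω f atTop fp) (hm : IsLimitAt Ω f atBot fm) {v : L2 Ω} {u w : ℕ → L2 Ω}
    {r : ℕ → ℝ} (hu : ∀ k, u k = r k • w k) (hr : Tendsto r atTop atTop)
    (hw : ∀ᵐ x ∂(volume.restrict Ω), Tendsto (fun k => w k x) atTop (𝓝 (v x))) :
    Tendsto (fun k => ∫ t in (0 : ℝ)..T, ∫ x in Ω, f t x (u k x) * v x) atTop
      (𝓝 (landesmanLazer fp fm T v)) := by
  have hv := integrable_L2 hf.isBounded v
  have hsub : Set.uIcc 0 T ⊆ Set.Ici 0 := by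
    rw [Set.uIcc_of_le hT]
    exact Set.Icc_subset_Ici_self
  have hbound : ∀ k, ∀ t : ℝ, 0 ≤ t → ∀ᵐ x ∂(volume.restrict Ω),
      ‖f t x (u k x) * v x‖ ≤ m * |v x| := by
    intro k t ht
    filter_upwards [ae_restrict_mem hf.isOpen.measurableSet] with x hx
    rw [Real.norm_eq_abs, abs_mul]
    exact mul_le_mul_of_nonneg_right (hf.bound t ht x hx _) (abs_nonneg _)
  have huk : ∀ᵐ x ∂(volume.restrict Ω), ∀ k, u k x = r k * w k x := by
    refine ae_all_iff.2 fun k => ?_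
    rw [hu k]
    exact Lp.coeFn_smul (r k) (w k)
  rw [hf.landesmanLazer_eq hT hp hm]
  refine intervalIntegral.tendsto_integral_filter_of_dominated_convergence
    (fun _ => ∫ x in Ω, m * |v x|) (Eventually.of_forall fun k => ?_)
    (Eventually.of_forall fun k => Eventually.of_forall fun t ht => ?_)
    intervalIntegrable_const (Eventually.of_forall fun t ht => ?_)
  · have h1 : ContinuousOn (fun t => ∫ x in Ω, f t x (u k x) * v x) (Set.uIcc 0 T) :=
      ((hf.continuousOn_inner_superposition (u k) v).congr
        fun t ht => (hf.inner_superposition ht (u k) v).symm).mono hsub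
    exact (h1.mono Set.uIoc_subset_uIcc).aestronglyMeasurable measurableSet_uIoc
  · exact norm_integral_le_of_norm_le (hv.abs.const_mul m)
      (hbound k t (hsub (Set.uIoc_subset_uIcc ht)))
  · have ht0 := hsub (Set.uIoc_subset_uIcc ht)
    refine tendsto_integral_of_dominated_convergence (fun x => m * |v x|)
      (fun k => (hf.aestronglyMeasurable ht0 (u k)).mul hv.aestronglyMeasurable)
      (hv.abs.const_mul m) (fun k => hbound k t ht0) ?_
    filter_upwards [hw, huk, ae_restrict_mem hf.isOpen.measurableSet] with x h1 h2 hx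
    simp_rw [h2]
    exact tendsto_mul hp hm ht0 hx h1 hr

/-- Under a Landesman-Lazer condition the averaged nonlinearity points outwards (`c > 0`) or
inwards (`c < 0`) far from the origin. -/
theorem exists_forall_inner_averaged_pos (hf : IsAdmissibleNonlinearity Ω f m L) (hT : 0 ≤ T)
    (hp : IsLimitAt Ω f atTop fp) (hm : IsLimitAt Ω f atBot fm) (N : Submodule ℝ (L2 Ω))
    [FiniteDimensional ℝ N] {c : ℝ}
    (hLL : ∀ u ∈ N, ‖u‖ = 1 → 0 < c * landesmanLazer fp fm T u) :
    ∃ R₀ : ℝ, 0 < R₀ ∧ ∀ u : N, R₀ ≤ ‖u‖ → 0 < c * inner ℝ (averaged f T N u) u := by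
  by_contra! hcon
  choose u hu hle using fun k : ℕ => hcon (k + 1) (by positivity)
  have hupos : ∀ k, 0 < ‖u k‖ := fun k => lt_of_lt_of_le (by positivity) (hu k)
  let w : ℕ → N := fun k => ‖u k‖⁻¹ • u k
  have hw1 : ∀ k, w k ∈ Metric.sphere (0 : N) 1 := by
    intro k
    rw [mem_sphere_zero_iff_norm, norm_smul, norm_inv, norm_norm, inv_mul_cancel₀ (hupos k).ne']
  obtain ⟨v, hv, φ, hφ, hlim⟩ := (isCompact_sphere (0 : N) 1).tendsto_subseq hw1
  have hlim' : Tendsto (fun k => (w (φ k) : L2 Ω)) atTop (𝓝 (v : L2 Ω)) :=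
    (continuous_subtype_val.tendsto v).comp hlim
  -- Convergence in `L²` gives convergence almost everywhere only along a further subsequence.
  obtain ⟨ψ, hψ, hae⟩ := (tendstoInMeasure_of_tendsto_Lp hlim').exists_seq_tendsto_ae
  have hσ : Tendsto (fun k => φ (ψ k)) atTop atTop := hφ.tendsto_atTop.comp hψ.tendsto_atTop
  have hnorm : Tendsto (fun k => ‖u (φ (ψ k))‖) atTop atTop := by
    refine tendsto_atTop_mono (fun k => ?_) (tendsto_natCast_atTop_atTop.comp hσ)
    exact (le_add_of_nonneg_right zero_le_one).trans (hu (φ (ψ k)))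
  have h1 : Tendsto (fun k => inner ℝ v (averaged f T N (u (φ (ψ k))))) atTop
      (𝓝 (landesmanLazer fp fm T (v : L2 Ω))) := by
    simp_rw [hf.inner_averaged hT]
    refine hf.tendsto_integral_landesmanLazer hT hp hm (fun k => ?_) hnorm hae
    change _ = ((‖u (φ (ψ k))‖ • w (φ (ψ k)) : N) : L2 Ω)
    rw [smul_inv_smul₀ (hupos _).ne']
  obtain ⟨M, hM⟩ := hf.exists_norm_averaged_le hT N
  -- Since `g` is bounded, testing against `w` instead of its limit `v` costs nothing in the limit.
  have h2 : Tendsto (fun k => inner ℝ (w (φ (ψ k)) - v) (averaged f T N (u (φ (ψ k))))) atTop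
      (𝓝 0) := by
    have h3 : Tendsto (fun k => ‖w (φ (ψ k)) - v‖ * M) atTop (𝓝 0) := by
      have := (tendsto_iff_norm_sub_tendsto_zero.1 (hlim.comp hψ.tendsto_atTop)).mul_const M
      rwa [zero_mul] at this
    refine squeeze_zero_norm (fun k => ?_) h3
    exact (norm_inner_le_norm _ _).trans (mul_le_mul_of_nonneg_left (hM _) (norm_nonneg _))
  have h4 := ((h1.add h2).const_mul c)
  rw [add_zero] at h4
  have h5 : c * landesmanLazer fp fm T (v : L2 Ω) ≤ 0 := by
    refine le_of_tendsto h4 (Eventually.of_forall fun k => ?_)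
    rw [← inner_add_left, add_sub_cancel]
    have h6 : inner ℝ (w (φ (ψ k))) (averaged f T N (u (φ (ψ k)))) =
        ‖u (φ (ψ k))‖⁻¹ * inner ℝ (u (φ (ψ k))) (averaged f T N (u (φ (ψ k)))) :=
      real_inner_smul_left (F := N) _ _ _
    rw [h6, real_inner_comm, mul_left_comm]
    exact mul_nonpos_of_nonneg_of_nonpos (inv_nonneg.2 (hupos _).le) (hle _)
  exact h5.not_gt (hLL v v.2 (mem_sphere_zero_iff_norm.1 hv))

theorem exists_forall_degree_averaged_eq (hf : IsAdmissibleNonlinearity Ω f m L) (hT : 0 ≤ T)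
    (hp : IsLimitAt Ω f atTop fp) (hm : IsLimitAt Ω f atBot fm) (N : Submodule ℝ (L2 Ω))
    [FiniteDimensional ℝ N] (hN : N ≠ ⊥) {c : ℝ} (hc : c ≠ 0)
    (hLL : ∀ u ∈ N, ‖u‖ = 1 → 0 < c * landesmanLazer fp fm T u) :
    ∃ R₀ : ℝ, 0 < R₀ ∧ (∀ u : N, R₀ ≤ ‖u‖ → averaged f T N u ≠ 0) ∧
      ∀ R : ℝ, R₀ ≤ R → BrouwerDegree.degree (averaged f T N) (Metric.ball 0 R) =
        ((SignType.sign (c ^ Module.finrank ℝ N) : SignType) : ℤ) := by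
  have : Nontrivial N := Submodule.nontrivial_iff_ne_bot.2 hN
  obtain ⟨R₀, hR₀, h⟩ := hf.exists_forall_inner_averaged_pos hT hp hm N hLL
  refine ⟨R₀, hR₀, fun u hu h0 => ?_, fun R hR => ?_⟩
  · have := h u hu
    rw [h0, inner_zero_left, mul_zero] at this
    exact lt_irrefl _ this
  · exact (BrouwerDegree.hasDegree_ball_of_inner_pos (hf.continuous_averaged hT N) hc
      (hR₀.trans_le hR) fun x hx => h x (hR.trans_eq hx.symm)).degree_eq

end IsAdmissibleNonlinearity

end LandesmanLazer

end Resonance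

theorem mainTheorem5
    {n : ℕ} (hn : 1 ≤ n)
    (Ω : Set (EuclideanSpace ℝ (Fin n))) (hΩo : IsOpen Ω) (hΩb : Bornology.IsBounded Ω)
    (T : ℝ) (hT : 0 < T)
    -- the nonlinearity `f` and its limits `f₊`, `f₋`
    (f : ℝ → EuclideanSpace ℝ (Fin n) → ℝ → ℝ)
    (hfc : ContinuousOn (fun p : ℝ × EuclideanSpace ℝ (Fin n) × ℝ => f p.1 p.2.1 p.2.2)
      (Set.Ici 0 ×ˢ Ω ×ˢ Set.univ))
    (hfb : ∃ m : ℝ, 0 < m ∧ ∀ t : ℝ, 0 ≤ t → ∀ x ∈ Ω, ∀ y : ℝ, |f t x y| ≤ m)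
    (hfL : ∃ L : ℝ, 0 < L ∧ ∀ t : ℝ, 0 ≤ t → ∀ x ∈ Ω, ∀ y₁ y₂ : ℝ,
      |f t x y₁ - f t x y₂| ≤ L * |y₁ - y₂|)
    (hfT : ∀ t : ℝ, 0 ≤ t → ∀ x ∈ Ω, ∀ y : ℝ, f t x y = f (t + T) x y)
    (fp fm : ℝ → EuclideanSpace ℝ (Fin n) → ℝ)
    (hfpc : ContinuousOn (fun p : ℝ × EuclideanSpace ℝ (Fin n) => fp p.1 p.2) (Set.Ici 0 ×ˢ Ω))
    (hfmc : ContinuousOn (fun p : ℝ × EuclideanSpace ℝ (Fin n) => fm p.1 p.2) (Set.Ici 0 ×ˢ Ω))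
    (hfp : ∀ t : ℝ, 0 ≤ t → ∀ x ∈ Ω, Tendsto (fun y => f t x y) atTop (𝓝 (fp t x)))
    (hfm : ∀ t : ℝ, 0 ≤ t → ∀ x ∈ Ω, Tendsto (fun y => f t x y) atBot (𝓝 (fm t x)))
    -- the operator `A`, where `-A` generates a compact semigroup, and its eigenvalue `l`
    (A : Resonance.L2 Ω →ₗ.[ℝ] Resonance.L2 Ω)
    (S : ℝ → Resonance.L2 Ω →L[ℝ] Resonance.L2 Ω)
    (hS : Resonance.IsCompactC0Semigroup S) (hA : Resonance.IsNegGenerator A S)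
    (l : ℝ) (hl : Resonance.eigenKer A l ≠ ⊥)
    (hker : Resonance.eigenKer A l = Resonance.eigenKer A.adjoint l)
    (hkerS : Resonance.eigenKer A l =
      LinearMap.ker ((ContinuousLinearMap.id ℝ (Resonance.L2 Ω) - Real.exp (l * T) • S T :
        Resonance.L2 Ω →L[ℝ] Resonance.L2 Ω) : Resonance.L2 Ω →ₗ[ℝ] Resonance.L2 Ω)) :
    ((∀ u ∈ Resonance.eigenKer A l, ‖u‖ = 1 → 0 < Resonance.landesmanLazer fp fm T u) →
      ∃ R₀ : ℝ, 0 < R₀ ∧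
        (∀ u : Resonance.eigenKer A l, R₀ ≤ ‖u‖ →
          Resonance.averaged f T (Resonance.eigenKer A l) u ≠ 0) ∧
        ∀ R : ℝ, R₀ ≤ R →
          BrouwerDegree.degree (Resonance.averaged f T (Resonance.eigenKer A l))
            (Metric.ball 0 R) = 1) ∧
    ((∀ u ∈ Resonance.eigenKer A l, ‖u‖ = 1 → Resonance.landesmanLazer fp fm T u < 0) →
      ∃ R₀ : ℝ, 0 < R₀ ∧
        (∀ u : Resonance.eigenKer A l, R₀ ≤ ‖u‖ →
          Resonance.averaged f T (Resonance.eigenKer A l) u ≠ 0) ∧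
        ∀ R : ℝ, R₀ ≤ R →
          BrouwerDegree.degree (Resonance.averaged f T (Resonance.eigenKer A l))
            (Metric.ball 0 R) = (-1) ^ Module.finrank ℝ (Resonance.eigenKer A l)) := by
  obtain ⟨m, -, hm⟩ := hfb
  obtain ⟨L, hL, hlip⟩ := hfL
  have hf : Resonance.IsAdmissibleNonlinearity Ω f m L :=
    ⟨hΩo, hΩb, hfc, hm, hL.le, hlip⟩
  have hp : Resonance.IsLimitAt Ω f atTop fp := ⟨hfpc, hfp⟩
  have hq : Resonance.IsLimitAt Ω f atBot fm := ⟨hfmc, hfm⟩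
  -- The eigenspace is the kernel of `I - exp(l T) S(T)`, and `S(T)` is compact because `T > 0`.
  have hfin : FiniteDimensional ℝ (Resonance.eigenKer A l) := by
    rw [hkerS]
    exact Resonance.finiteDimensional_ker_id_sub_smul (hS.compact T hT) _
  constructor
  · intro h
    have := hf.exists_forall_degree_averaged_eq hT.le hp hq _ hl (c := 1) one_ne_zero
      fun u hu h1 => by simpa using h u hu h1
    simpa using this
  · intro h
    have := hf.exists_forall_degree_averaged_eq hT.le hp hq _ hl (c := -1) (by norm_num)
      fun u hu h1 => by simpa using h u hu h1
    have hsign : ((SignType.sign ((-1 : ℝ) ^ Module.finrank ℝ (Resonance.eigenKer A l)) :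
        SignType) : ℤ) = (-1) ^ Module.finrank ℝ (Resonance.eigenKer A l) := by
      rcases neg_one_pow_eq_or ℤ (Module.finrank ℝ (Resonance.eigenKer A l)) with h1 | h1
      · have h2 : (-1 : ℝ) ^ Module.finrank ℝ (Resonance.eigenKer A l) = 1 := by exact_mod_cast h1
        rw [h1, h2]
        simp
      · have h2 : (-1 : ℝ) ^ Module.finrank ℝ (Resonance.eigenKer A l) = -1 := by
          exact_mod_cast h1
        rw [h1, h2]
        simp
    rwa [hsign] at this
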